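/- **Setting.** A network $N$ with finite cell set $C$ and $k\ge 1$ edge types is given by maps $\sigma_1,\dots,\sigma_k:C\to C$ ($\sigma_i(c)$ is the source of the unique edge of type $i$ with target $c$). It is a (connected) feed-forward network if it is connected as an undirected graph and $C$ is partitioned into nonempty layers $C_0,\dots,C_m$ with $\sigma_i(c)=c$ for $c\in C_0$, $\sigma_i(C_j)\subseteq C_{j-1}$ for $1\le j\le m$, and every cell of $C_j$, $j<m$, equal to $\sigma_i(c')$ for some $i$ and some $c'\in C_{j+1}$. Let $\mathcal V_0(N)$ be the set of smooth $f:\mathbb R\times\mathbb R^k\times\mathbb R\to\mathbb R$, $(x_0,(x_1,\dots,x_k),\lambda)\mapsto f$, with $f(0,0,\lambda)=0$ for all $\lambda$ and $f_0=0$. Put $(f^N(x,\lambda))_c=f(x_c,x_{\sigma_1(c)},\dots,x_{\sigma_k(c)},\lambda)$. Here $f_0$, $f_i$, $f_{00}$, $f_{0\lambda}$ are the derivatives $\partial_{x_0}f$, $\partial_{x_i}f$, $\partial^2_{x_0}f$, $\partial_{x_0}\partial_\lambda f$ at the origin. A domain is an interval $]-r,0]$, $]-r,r[$ or $[0,r[$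 with $r>0$. A curve on a domain $D$ is a map $b:D\to\mathbb R^{C}$ that is continuous on $D$ and smooth on the interior of $D$. Germs of curves are the classes of the equivalence relation generated by: $b_1:D_1\to\mathbb R^{C}$ and $b_2:D_2\to\mathbb R^{C}$ are related if for some open $U\ni 0$ one has $U\cap D_1\cap D_2\ne\{0\}$ and $b_1=b_2$ on $U\cap D_1\cap D_2$. An equilibrium curve is a curve with $b(0)=0$ and $f^N(b(\lambda),\lambda)=0$ for all $\lambda\in D$; $\mathcal B(N,f)$ is the set of germs of equilibrium curves (equilibrium branches). On a one-sided domain, a scalar germ $u$ that vanishes near $0$ has square-root-order $-1$ and slope $0$. Otherwise $u$ has square-root-order $p\ge0$ and slope $s$ if $p$ is the smallest non-negative integer for which, near $0$, $u(\lambda)=u^*(|\lambda|^{2^{-p}})$ with $u^*$ smooth on some $[0,\varepsilon[$ and with $\lim_{\lambda\to0,\ \lambda\in D\setminus\{0\}}u^*(|\lambda|)/\lambda$ existing and nonzero; $s$ is this limit. On a two-sided domain, $u$ has square-root-order $p$ and slope $s$ if both one-sided restrictions do. For $b\in\mathcal B(N,f)$ let $\Theta(b)=(\delta,(p_c)_{c\in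 C},(s_c)_{c\in C})\in\{-1,0,1\}\times\mathbb Z^{C}\times\mathbb R^{C}$, where $\delta=0$ if some curve in the germ $b$ is defined on a neighbourhood of $0$, $\delta=1$ (resp. $-1$) if all curves in it are defined only for $\lambda\ge0$ (resp. $\lambda\le0$), and the component at $c$ of every equilibrium curve in the germ $b$ has square-root-order $p_c$ and slope $s_c$. Let $\Omega(N,f)$ be the set of $(\delta,(p_c)_c,(s_c)_c)\in\{-1,0,1\}\times\mathbb Z^{C}\times\mathbb R^{C}$ with $p_c\ge-1$ for all $c$ such that, for every cell $c$, - $\Omega.1$: $\delta=0$ if and only if $p_{c'}\le0$ for all cells $c'$; - $\Omega.2$: if $p_c=-1$, then $p_{\sigma_i(c)}=-1$ for all $i$; - $\Omega.3$: if $p_c>-1$, then $p_{\sigma_i(c)}\le p_c-1$ for all $i$, with equality for at least one $i$; - $\Omega.4$: $p_c=-1$ if and only if $s_c=0$; - $\Omega.5$: if $p_c=0$, then $s_c=-2f_{0\lambda}/f_{00}$; - $\Omega.6$: if $p_c>0$, then $-\frac{2\delta}{f_{00}}\sum_{i\in A_c}f_is_{\sigma_i(c)}\ge0$ and $s_c=\pm\sqrt{-\frac{2\delta}{f_{00}}\sum_{i\in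 A_c}f_is_{\sigma_i(c)}}$, where $A_c=\{i:p_{\sigma_i(c)}=p_c-1\}$. **Proposition.** Let $N$ be a connected feed-forward network. For generic $f\in\mathcal V_0(N)$, that is, for all $f\in\mathcal V_0(N)$ whose coefficients $((f_1,\dots,f_k),f_{00},f_{0\lambda})$ lie in a certain open dense subset of $\mathbb R^k\times\mathbb R\times\mathbb R$ depending only on $N$, the data $\Theta(b)$ exist and are unique for every $b\in\mathcal B(N,f)$, and $\Theta$ is a bijection from $\mathcal B(N,f)$ onto $\Omega(N,f)$. -/

import Mathlib

open scoped ContDiff Topology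

noncomputable section

namespace FeedForward

/-! ### Networks -/

/-- A network with set of cells `C` and `k` edge types in which every cell is the target of exactly
one edge of each type: `N.input i c` is the source of the edge of type `i` with target `c`. -/
structure Network (C : Type*) (k : ℕ) where
  input : Fin k → C → C

/-- The cells split into nonempty layers `0, …, m`; the cells of layer `0` receive only from
themselves, those of layer `j + 1` only from layer `j`, and every cell outside the last layer is the
source of some edge whose target lies in the next layer. -/
def Network.IsFeedForward {C : Type*} {k : ℕ} (N : Network C k) : Prop :=
  ∃ (m : ℕ) (layer : C → ℕ),
    (∀ j, (∃ c, layer c = j) ↔ j ≤ m) ∧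
    (∀ c, layer c = 0 → ∀ i, N.input i c = c) ∧
    (∀ c j, layer c = j + 1 → ∀ i, layer (N.input i c) = j) ∧
    (∀ c, layer c < m → ∃ c' i, layer c' = layer c + 1 ∧ N.input i c' = c)

/-- Connectedness of the underlying undirected graph. -/
def Network.IsConnected {C : Type*} {k : ℕ} (N : Network C k) : Prop :=
  ∀ c c' : C, Relation.ReflTransGen
    (fun a b => (∃ i, N.input i b = a) ∨ (∃ i, N.input i a = b)) c c'

/-! ### Coupled cell systems.  The arguments of `f` are `(x₀, (x₁, …, x_k), parameter)`. -/

/-- The admissible family `f^N`. -/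
def Network.field {C : Type*} {k : ℕ} (N : Network C k) (f : ℝ × (Fin k → ℝ) × ℝ → ℝ)
    (x : C → ℝ) (l : ℝ) : C → ℝ :=
  fun c => f (x c, fun i => x (N.input i c), l)

/-- `f₀ = ∂f/∂x₀` at the origin. -/
def dInternal {k : ℕ} (f : ℝ × (Fin k → ℝ) × ℝ → ℝ) : ℝ :=
  deriv (fun t : ℝ => f (t, 0, 0)) 0

/-- `f_i = ∂f/∂x_i` at the origin, for the `i`-th input. -/
def dInput {k : ℕ} (f : ℝ × (Fin k → ℝ) × ℝ → ℝ) (i : Fin k) : ℝ :=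
  deriv (fun t : ℝ => f (0, Pi.single i t, 0)) 0

/-- `f₀₀ = ∂²f/∂x₀²` at the origin. -/
def dInternal2 {k : ℕ} (f : ℝ × (Fin k → ℝ) × ℝ → ℝ) : ℝ :=
  iteratedDeriv 2 (fun t : ℝ => f (t, 0, 0)) 0

/-- `f_{0λ} = ∂²f/∂x₀∂λ` at the origin. -/
def dInternalParam {k : ℕ} (f : ℝ × (Fin k → ℝ) × ℝ → ℝ) : ℝ :=
  deriv (fun l : ℝ => deriv (fun t : ℝ => f (t, 0, l)) 0) 0

/-- Smooth families with the trivial equilibrium for all parameters, and with a bifurcation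
condition associated with the internal dynamics, `f₀ = 0`. -/
def internalFamilies (k : ℕ) : Set (ℝ × (Fin k → ℝ) × ℝ → ℝ) :=
  {f | ContDiff ℝ ∞ f ∧ (∀ l : ℝ, f (0, 0, l) = 0) ∧ dInternal f = 0}

/-- The part `((f_1, …, f_k), f₀₀, f_{0λ})` of the 2-jet of `f` at the origin. -/
def coefficients {k : ℕ} (f : ℝ × (Fin k → ℝ) × ℝ → ℝ) : (Fin k → ℝ) × ℝ × ℝ :=
  (dInput f, dInternal2 f, dInternalParam f)

/-! ### Germs of branches -/

/-- The domains `]-r, 0]` (sign `-1`), `]-r, r[` (sign `0`) and `[0, r[` (sign `1`). -/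
def domainSet : SignType → ℝ → Set ℝ
  | .neg, r => Set.Ioc (-r) 0
  | .zero, r => Set.Ioo (-r) r
  | .pos, r => Set.Ico 0 r

/-- A curve in `ℝ^C` on a domain: continuous on the domain and smooth on its interior.  (At the end
point `0` of a one-sided domain only continuity is required, so that square roots are allowed; on a
two-sided domain the curve is smooth at `0`.)  Values outside the domain are irrelevant. -/
structure Curve (C : Type*) [Fintype C] where
  sign : SignType
  radius : ℝ
  radius_pos : 0 < radius
  toFun : ℝ → C → ℝ
  continuousOn_toFun : ContinuousOn toFun (domainSet sign radius)
  smoothOn_toFun : ContDiffOn ℝ ∞ toFun (interior (domainSet sign radius))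

/-- The domain of a curve. -/
def Curve.dom {C : Type*} [Fintype C] (b : Curve C) : Set ℝ := domainSet b.sign b.radius

/-- Two curves agree near `0` on their common domain, which must not be only `{0}`. -/
def GermEquivalent {C : Type*} [Fintype C] (b₁ b₂ : Curve C) : Prop :=
  ∃ U : Set ℝ, IsOpen U ∧ 0 ∈ U ∧ U ∩ b₁.dom ∩ b₂.dom ≠ {0} ∧
    Set.EqOn b₁.toFun b₂.toFun (U ∩ b₁.dom ∩ b₂.dom)

/-- Germs of curves: the quotient by the equivalence relation generated by `GermEquivalent`. -/
def CurveGerm (C : Type*) [Fintype C] : Type _ := Quot (@GermEquivalent C _)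

/-- The germ of a curve. -/
def Curve.germ {C : Type*} [Fintype C] (b : Curve C) : CurveGerm C := Quot.mk _ b

/-- The curve passes through the origin and consists of equilibria of `f^N`. -/
def Curve.IsEquilibrium {C : Type*} [Fintype C] {k : ℕ} (b : Curve C) (N : Network C k)
    (f : ℝ × (Fin k → ℝ) × ℝ → ℝ) : Prop :=
  b.toFun 0 = 0 ∧ ∀ l ∈ b.dom, N.field f (b.toFun l) l = 0

/-- The set `B(N, f)` of equilibrium branches (through the origin) of `f` on `N`. -/
def equilibriumBranches {C : Type*} [Fintype C] {k : ℕ} (N : Network C k)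
    (f : ℝ × (Fin k → ℝ) × ℝ → ℝ) : Set (CurveGerm C) :=
  {β | ∃ b : Curve C, b.germ = β ∧ b.IsEquilibrium N f}

/-! ### Square-root-orders and slopes -/

/-- On the side `τ` (`1` or `-1`) of `0`, `u l = v (|l| ^ (2 ^ (-q)))` near `0` with `v` smooth on
`[0, r ^ (2 ^ (-q))[`, and `v |l| / l` tends to `s ≠ 0`. -/
def HasRootForm (τ : SignType) (u : ℝ → ℝ) (q : ℕ) (s : ℝ) : Prop :=
  s ≠ 0 ∧ ∃ r : ℝ, 0 < r ∧ ∃ v : ℝ → ℝ,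
    ContDiffOn ℝ ∞ v (Set.Ico 0 (r ^ ((1 : ℝ) / 2 ^ q))) ∧
    (∀ l ∈ domainSet τ r, u l = v (|l| ^ ((1 : ℝ) / 2 ^ q))) ∧
    Filter.Tendsto (fun l => v |l| / l) (𝓝[domainSet τ r \ {0}] 0) (𝓝 s)

/-- On the side `τ` of `0`, the scalar germ `u` has square-root-order `p` and slope `s`. -/
def HasOrderAndSlope (τ : SignType) (u : ℝ → ℝ) (p : ℤ) (s : ℝ) : Prop :=
  (p = -1 ∧ s = 0 ∧ ∃ r : ℝ, 0 < r ∧ ∀ l ∈ domainSet τ r, u l = 0) ∨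
  (∃ q : ℕ, p = q ∧ HasRootForm τ u q s ∧ ∀ q' < q, ∀ s', ¬ HasRootForm τ u q' s')

/-- The component of `b` at the cell `c` has square-root-order `p` and slope `s`, on each side of
`0` on which `b` is defined. -/
def Curve.HasOrderAndSlopeAt {C : Type*} [Fintype C] (b : Curve C) (c : C) (p : ℤ) (s : ℝ) :
    Prop :=
  ∀ τ : SignType, τ ≠ 0 → (b.sign = 0 ∨ b.sign = τ) →
    HasOrderAndSlope τ (fun l => b.toFun l c) p s

/-- The domain sign of a germ: `0` if some representative is defined on a neighbourhood of `0`,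
and `1` (`-1`) if all representatives are defined only for `l ≥ 0` (`l ≤ 0`). -/
def HasDomainSign {C : Type*} [Fintype C] (β : CurveGerm C) (δ : SignType) : Prop :=
  (δ = 0 ∧ ∃ b : Curve C, b.germ = β ∧ b.sign = 0) ∨
  (δ ≠ 0 ∧ ∀ b : Curve C, b.germ = β → b.sign = δ)

/-- `d = (δ, p, s)` consists of the domain sign, the square-root-orders and the slopes of the
equilibrium branch `β`. -/
def IsBranchData {C : Type*} [Fintype C] {k : ℕ} (N : Network C k)
    (f : ℝ × (Fin k → ℝ) × ℝ → ℝ) (β : CurveGerm C) (d : SignType × (C → ℤ) × (C → ℝ)) : Prop :=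
  HasDomainSign β d.1 ∧
  ∀ b : Curve C, b.germ = β → b.IsEquilibrium N f →
    ∀ c, b.HasOrderAndSlopeAt c (d.2.1 c) (d.2.2 c)

/-- The expression `-(2δ / f₀₀) ∑_{i ∈ A_c} f_i s_{σ_i(c)}` with `A_c = {i | p_{σ_i(c)} = p_c - 1}`. -/
def slopeRadicand {C : Type*} {k : ℕ} (N : Network C k) (f : ℝ × (Fin k → ℝ) × ℝ → ℝ)
    (δ : SignType) (p : C → ℤ) (s : C → ℝ) (c : C) : ℝ :=
  -(2 * (δ : ℝ) / dInternal2 f) *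
    ∑ i ∈ Finset.univ.filter (fun i : Fin k => p (N.input i c) = p c - 1),
      dInput f i * s (N.input i c)

/-- The set `Ω(N, f)` of admissible data. -/
def admissibleData {C : Type*} {k : ℕ} (N : Network C k) (f : ℝ × (Fin k → ℝ) × ℝ → ℝ) :
    Set (SignType × (C → ℤ) × (C → ℝ)) :=
  {d | match d with
    | (δ, p, s) =>
      (∀ c, -1 ≤ p c) ∧
      (δ = 0 ↔ ∀ c, p c ≤ 0) ∧
      (∀ c, p c = -1 → ∀ i, p (N.input i c) = -1) ∧
      (∀ c, -1 < p c →
        (∀ i, p (N.input i c) ≤ p c - 1) ∧ ∃ i, p (N.input i c) = p c - 1) ∧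
      (∀ c, p c = -1 ↔ s c = 0) ∧
      (∀ c, p c = 0 → s c = -(2 * dInternalParam f / dInternal2 f)) ∧
      (∀ c, 0 < p c →
        0 ≤ slopeRadicand N f δ p s c ∧
        (s c = √(slopeRadicand N f δ p s c) ∨ s c = -√(slopeRadicand N f δ p s c)))}

end FeedForward

end

/-!
Fix one side `τ = ±1` of `0`. The cells are treated layer by layer. In the first layer a cell
receives only from itself, and since the sum of the `f_i` is nonzero its component vanishes
(`eventually_eq_zero_of_self_coupled`). For a later cell, suppose that the inputs are known and
that `q - 1` is their largest square-root-order. With `|λ| = z ^ (2 ^ q)` the inputs become `z ^ 2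
ξ(z)` and the parameter becomes `z μ(z)`, with `ξ` and `μ` smooth near `z = 0` on both sides
(`HasBranchForm.exists_rescale`). Substituting `x₀ = z y`, two applications of Hadamard's lemma
give `f (z y, z ^ 2 ξ, z μ) = z ^ 2 H(y, ξ, μ, z)` with `H` smooth and `H(y, ξ, μ, 0) = f₀₀ y ^ 2
/ 2 + f_{0λ} μ y + ∑ f_i ξ_i` (`exists_blowUp`). For generic `f` this quadratic polynomial in `y`
has no double root at the relevant `ξ(0)`, `μ(0)`. The implicit function theorem then yields one
smooth branch `y = Y(z)` for each root (`exists_localBranch`), and every small continuous solution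
follows one of them (`exists_tendsto_div_of_solution`): using `x₀` itself as the scale of the
blow-up shows that `x₀ / z` stays bounded, and the sign of the derivative of the quadratic cannot
change along a solution. The roots are exactly the slopes that the conditions on admissible data
prescribe, so induction over the layers gives orders and slopes for every branch
(`exists_orders_slopes`), uniqueness for given orders and slopes
(`eventually_eq_of_orders_slopes`), and existence for all admissible data (`exists_curve`).

Genericity means that `f₀₀`, `f_{0λ}` and `∑ f_i` do not vanish and that no slope can vanish. A
slope of order `q` is one of finitely many functions of the coefficients, built from nested square
roots (`slopeFamily`), each continuous where `f₀₀ ≠ 0`, so the generic set is open. For density,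
take rational coefficients with prescribed `3`-adic absolute values. The slopes are then algebraic
numbers, and the algebraic numbers embed into the algebraic closure of the `3`-adic numbers. If
the exponents of the `f_i` are sufficiently independent, then the terms in the sum under each root
have pairwise distinct absolute values, so no such sum vanishes (`padic_norm_slope`). Such
coefficients are dense.

A germ of curves does not remember the side on which a representative is defined if it contains a
two-sided curve. In that case the derivative at `0` is an invariant of the germ, and it determines
all orders, which are at most `0`, and all slopes. If some order is positive, no representative is
differentiable at `0`; then all of them live on the same side and agree near `0`.
-/

noncomputable section

namespace FeedForward

open Filter Set

/-! ### Hadamard's lemma -/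

section Hadamard

universe u

theorem hasFDerivAt_intervalIntegral_param {E F : Type u} [NormedAddCommGroup E] [NormedSpace ℝ E]
    [FiniteDimensional ℝ E] [NormedAddCommGroup F] [NormedSpace ℝ F] [CompleteSpace F]
    {φ : E × ℝ → F} (hφ : ContDiff ℝ ∞ φ) (x₀ : E) :
    HasFDerivAt (fun x => ∫ t in (0 : ℝ)..1, φ (x, t))
      (∫ t in (0 : ℝ)..1, (fderiv ℝ φ (x₀, t)).comp (ContinuousLinearMap.inl ℝ E ℝ)) x₀ := by
  have hc : Continuous φ := hφ.continuous
  have hd : Continuous fun q : E × ℝ => (fderiv ℝ φ q).comp (ContinuousLinearMap.inl ℝ E ℝ) :=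
    (hφ.continuous_fderiv (by simp)).clm_comp continuous_const
  have : ProperSpace E := FiniteDimensional.proper ℝ E
  obtain ⟨M, hM⟩ := ((isCompact_closedBall x₀ 1).prod
    (isCompact_uIcc (a := (0 : ℝ)) (b := 1))).exists_bound_of_continuousOn hd.continuousOn
  refine intervalIntegral.hasFDerivAt_integral_of_dominated_of_fderiv_le (bound := fun _ => M)
    (F' := fun x t => (fderiv ℝ φ (x, t)).comp (ContinuousLinearMap.inl ℝ E ℝ))
    (s := Metric.closedBall x₀ 1) (Metric.closedBall_mem_nhds x₀ one_pos) ?_ ?_ ?_ ?_ ?_ ?_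
  · exact Filter.Eventually.of_forall fun x =>
      (hc.comp (Continuous.prodMk_right x)).aestronglyMeasurable
  · exact (hc.comp (Continuous.prodMk_right x₀)).intervalIntegrable _ _
  · exact (hd.comp (Continuous.prodMk_right x₀)).aestronglyMeasurable
  · exact Filter.Eventually.of_forall fun t ht x hx =>
      hM (x, t) ⟨hx, Set.uIoc_subset_uIcc ht⟩
  · exact intervalIntegrable_const
  · refine Filter.Eventually.of_forall fun t _ x _ => ?_
    have h1 : HasFDerivAt φ (fderiv ℝ φ (x, t)) (x, t) :=
      (hφ.differentiable (by simp) (x, t)).hasFDerivAt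
    exact h1.comp x (hasFDerivAt_prodMk_left x t)

/-- Integrating a smooth function over `[0, 1]` in one variable leaves a smooth function of the
others. -/
theorem contDiff_intervalIntegral_param {E : Type u} [NormedAddCommGroup E] [NormedSpace ℝ E]
    [FiniteDimensional ℝ E] {F : Type u} [NormedAddCommGroup F] [NormedSpace ℝ F]
    [CompleteSpace F] {φ : E × ℝ → F} (hφ : ContDiff ℝ ∞ φ) :
    ContDiff ℝ ∞ (fun x => ∫ t in (0 : ℝ)..1, φ (x, t)) := by
  rw [contDiff_infty]
  intro n
  induction n generalizing F with
  | zero =>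
    exact contDiff_zero.2 (continuous_iff_continuousAt.2 fun x =>
      (hasFDerivAt_intervalIntegral_param hφ x).continuousAt)
  | succ n ih =>
    have : ((n + 1 : ℕ) : ℕ∞ω) = n + 1 := by norm_cast
    rw [this, contDiff_succ_iff_hasFDerivAt]
    exact ⟨_, ih (φ := fun q => (fderiv ℝ φ q).comp (ContinuousLinearMap.inl ℝ E ℝ))
      ((hφ.fderiv_right (m := ∞) (by simp)).clm_comp contDiff_const),
      hasFDerivAt_intervalIntegral_param hφ⟩

/-- Hadamard's lemma in the last variable. -/
theorem exists_smooth_quotient {E : Type} [NormedAddCommGroup E] [NormedSpace ℝ E]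
    [FiniteDimensional ℝ E] {Φ : E × ℝ → ℝ} (hΦ : ContDiff ℝ ∞ Φ) :
    ∃ Ψ : E × ℝ → ℝ, ContDiff ℝ ∞ Ψ ∧ (∀ a z, Φ (a, z) = Φ (a, 0) + z * Ψ (a, z)) ∧
      ∀ a, Ψ (a, 0) = deriv (fun z => Φ (a, z)) 0 := by
  have hder : ∀ a z, HasDerivAt (fun z => Φ (a, z)) (fderiv ℝ Φ (a, z) (0, 1)) z := by
    intro a z
    have h1 : HasFDerivAt Φ (fderiv ℝ Φ (a, z)) (a, z) :=
      (hΦ.differentiable (by simp) (a, z)).hasFDerivAt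
    have h2 : HasDerivAt (fun z : ℝ => (a, z)) ((0 : E), (1 : ℝ)) z :=
      (hasDerivAt_const z a).prodMk (hasDerivAt_id z)
    exact h1.comp_hasDerivAt z h2
  have hD : ContDiff ℝ ∞ fun q : E × ℝ => fderiv ℝ Φ q (0, 1) :=
    (hΦ.fderiv_right (m := ∞) (by simp)).clm_apply contDiff_const
  refine ⟨fun q => ∫ t in (0 : ℝ)..1, fderiv ℝ Φ (q.1, t * q.2) (0, 1), ?_, ?_, ?_⟩
  · exact contDiff_intervalIntegral_param
      (φ := fun q : (E × ℝ) × ℝ => fderiv ℝ Φ (q.1.1, q.2 * q.1.2) (0, 1))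
      (hD.comp (by fun_prop))
  · intro a z
    have h1 : ∀ t ∈ Set.uIcc (0 : ℝ) 1, HasDerivAt (fun t : ℝ => Φ (a, t * z))
        (fderiv ℝ Φ (a, t * z) (0, 1) * z) t := by
      intro t _
      have h2 : HasDerivAt (fun t : ℝ => t * z) z t := by
        simpa using (hasDerivAt_id t).mul_const z
      exact (hder a (t * z)).comp t h2
    have hcont : Continuous fun t : ℝ => fderiv ℝ Φ (a, t * z) (0, 1) :=
      hD.continuous.comp (by fun_prop)
    have h3 := intervalIntegral.integral_eq_sub_of_hasDerivAt h1
      ((hcont.mul continuous_const).intervalIntegrable _ _)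
    rw [intervalIntegral.integral_mul_const] at h3
    simp only [one_mul, zero_mul] at h3
    linarith
  · intro a
    simp [(hder a 0).deriv]

end Hadamard

/-! ### The blow-up of the response function -/

section BlowUp

variable {k : ℕ} {f : ℝ × (Fin k → ℝ) × ℝ → ℝ}

/-- The part of lowest order of `f` when the internal variable and the parameter are of first order
and the inputs are of second order. -/
def leadingForm (f : ℝ × (Fin k → ℝ) × ℝ → ℝ) (y : ℝ) (ξ : Fin k → ℝ) (μ : ℝ) : ℝ :=
  dInternal2 f / 2 * y ^ 2 + dInternalParam f * μ * y + ∑ i, dInput f i * ξ i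

theorem fderiv_input_eq_sum (hf : f ∈ internalFamilies k) (ξ : Fin k → ℝ) :
    fderiv ℝ f 0 (0, ξ, 0) = ∑ i, dInput f i * ξ i := by
  have hd : HasFDerivAt f (fderiv ℝ f 0) 0 := (hf.1.differentiable (by simp) 0).hasFDerivAt
  have h1 : ∀ i, dInput f i = fderiv ℝ f 0 (0, Pi.single i 1, 0) := by
    intro i
    have h2 : HasDerivAt (fun t : ℝ => ((0 : ℝ), (Pi.single i t : Fin k → ℝ), (0 : ℝ)))
        (0, Pi.single i 1, 0) 0 := by
      refine (hasDerivAt_const _ _).prodMk (HasDerivAt.prodMk ?_ (hasDerivAt_const _ _))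
      rw [hasDerivAt_pi]
      intro j
      by_cases h : j = i
      · subst h; simpa using hasDerivAt_id' (0 : ℝ)
      · simpa [Pi.single_eq_of_ne h] using hasDerivAt_const (0 : ℝ) (0 : ℝ)
    have h3 : HasFDerivAt f (fderiv ℝ f 0)
        ((0 : ℝ), (Pi.single i (0 : ℝ) : Fin k → ℝ), (0 : ℝ)) := by
      rw [Pi.single_zero]; exact hd
    exact (h3.comp_hasDerivAt (0 : ℝ) h2).deriv
  have h4 : ((0 : ℝ), ξ, (0 : ℝ)) =
      ∑ i, ξ i • ((0 : ℝ), (Pi.single i 1 : Fin k → ℝ), (0 : ℝ)) := by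
    refine Prod.ext ?_ (Prod.ext ?_ ?_)
    · simp [Prod.fst_sum]
    · ext j
      simp [Prod.fst_sum, Prod.snd_sum, Finset.sum_apply, Pi.single_apply]
    · simp [Prod.snd_sum]
  rw [h4, map_sum]
  exact Finset.sum_congr rfl fun i _ => by rw [map_smul, h1, smul_eq_mul, mul_comm]

theorem fderiv_internal_eq_zero (hf : f ∈ internalFamilies k) (y μ : ℝ) :
    fderiv ℝ f 0 (y, 0, μ) = 0 := by
  have hd : HasFDerivAt f (fderiv ℝ f 0) ((0 : ℝ), (0 : Fin k → ℝ), (0 : ℝ)) :=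
    (hf.1.differentiable (by simp) 0).hasFDerivAt
  have h1 : fderiv ℝ f 0 (1, 0, 0) = 0 := by
    have h2 : HasDerivAt (fun t : ℝ => (t, (0 : Fin k → ℝ), (0 : ℝ))) (1, 0, 0) 0 :=
      (hasDerivAt_id _).prodMk (hasDerivAt_const _ _)
    exact (hd.comp_hasDerivAt (0 : ℝ) h2).deriv.symm.trans hf.2.2
  have h2 : fderiv ℝ f 0 (0, 0, 1) = 0 := by
    have h2 : HasDerivAt (fun t : ℝ => ((0 : ℝ), (0 : Fin k → ℝ), t)) (0, 0, 1) 0 :=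
      (hasDerivAt_const _ _).prodMk ((hasDerivAt_const _ _).prodMk (hasDerivAt_id _))
    have h3 := (hd.comp_hasDerivAt (0 : ℝ) h2).deriv
    rw [← h3]
    have : (f ∘ fun t : ℝ => ((0 : ℝ), (0 : Fin k → ℝ), t)) = fun _ => 0 := funext hf.2.1
    rw [this]; simp
  have h3 : (y, (0 : Fin k → ℝ), μ) = y • ((1 : ℝ), (0 : Fin k → ℝ), (0 : ℝ)) +
      μ • ((0 : ℝ), (0 : Fin k → ℝ), (1 : ℝ)) := by
    simp
  rw [h3, map_add, map_smul, map_smul, h1, h2]; simp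

/-- The contribution of the internal variable and the parameter to the leading form. Dividing
`f (x, 0, λ)` by `x` reduces both second derivatives to first derivatives of the quotient. -/
theorem tendsto_internal_div_sq (hf : f ∈ internalFamilies k) (y μ : ℝ) :
    Filter.Tendsto (fun z : ℝ => f (z * y, 0, z * μ) / z ^ 2) (𝓝[≠] 0)
      (𝓝 (dInternal2 f / 2 * y ^ 2 + dInternalParam f * μ * y)) := by
  obtain ⟨Ψ, hΨ, hΨ1, hΨ2⟩ := exists_smooth_quotient
    (Φ := fun q : ℝ × ℝ => f (q.2, 0, q.1)) (hf.1.comp (by fun_prop))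
  simp only [hf.2.1, zero_add] at hΨ1
  have hΨ0 : Ψ (0, 0) = 0 := by rw [hΨ2]; exact hf.2.2
  have hd : HasFDerivAt Ψ (fderiv ℝ Ψ (0, 0)) (0, 0) :=
    (hΨ.differentiable (by simp) _).hasFDerivAt
  have hl : fderiv ℝ Ψ (0, 0) (1, 0) = dInternalParam f := by
    have h2 : HasDerivAt (fun t : ℝ => (t, (0 : ℝ))) (1, 0) 0 :=
      (hasDerivAt_id _).prodMk (hasDerivAt_const _ _)
    rw [← (HasFDerivAt.comp_hasDerivAt (f := fun t : ℝ => (t, (0 : ℝ))) (0 : ℝ) hd h2).deriv]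
    unfold dInternalParam
    congr 1
    ext t; simp [hΨ2]
  have hx : fderiv ℝ Ψ (0, 0) (0, 1) = dInternal2 f / 2 := by
    have h2 : ∀ t : ℝ, HasDerivAt (fun t : ℝ => ((0 : ℝ), t)) (0, 1) t := fun t =>
      (hasDerivAt_const _ _).prodMk (hasDerivAt_id _)
    set χ : ℝ → ℝ := fun t => Ψ (0, t) with hχ
    have hχs : ContDiff ℝ ∞ χ := hΨ.comp (by fun_prop)
    have hχd : ∀ t, HasDerivAt χ (deriv χ t) t := fun t =>
      (hχs.differentiable (by simp) t).hasDerivAt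
    have h3 : fderiv ℝ Ψ (0, 0) (0, 1) = deriv χ 0 :=
      ((hd.comp_hasDerivAt (0 : ℝ) (h2 0)).deriv).symm
    have h4 : (fun t : ℝ => f (t, 0, 0)) = fun t => t * χ t := by
      ext t; exact hΨ1 0 t
    have h5 : deriv (fun t : ℝ => t * χ t) = fun t => χ t + t * deriv χ t := by
      ext t
      simpa using! ((hasDerivAt_id' t).fun_mul (hχd t)).deriv
    have h6 : HasDerivAt (fun t : ℝ => χ t + t * deriv χ t)
        (deriv χ 0 + (1 * deriv χ 0 + 0 * deriv (deriv χ) 0)) 0 := by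
      have h7 : ContDiff ℝ ∞ (deriv χ) := (contDiff_infty_iff_deriv.1 hχs).2
      exact (hχd 0).add ((hasDerivAt_id (0 : ℝ)).mul
        (h7.differentiable (by simp) 0).hasDerivAt)
    rw [h3, dInternal2, iteratedDeriv_succ, iteratedDeriv_one, h4, h5, h6.deriv]
    ring
  have hcurve : HasDerivAt (fun z : ℝ => (z * μ, z * y)) (μ, y) 0 := by
    simpa using ((hasDerivAt_id (0 : ℝ)).mul_const μ).prodMk
      ((hasDerivAt_id (0 : ℝ)).mul_const y)
  have hd' : HasFDerivAt Ψ (fderiv ℝ Ψ (0, 0)) ((0 : ℝ) * μ, (0 : ℝ) * y) := by simpa using hd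
  have h8 := hasDerivAt_iff_tendsto_slope.1 (hd'.comp_hasDerivAt (0 : ℝ) hcurve)
  have h9 : fderiv ℝ Ψ (0, 0) (μ, y) = μ * dInternalParam f + y * (dInternal2 f / 2) := by
    have : (μ, y) = μ • ((1 : ℝ), (0 : ℝ)) + y • ((0 : ℝ), (1 : ℝ)) := by simp
    rw [this, map_add, map_smul, map_smul, hl, hx]; simp
  have h10 := h8.const_mul y
  rw [h9] at h10
  convert h10.congr' ?_ using 2
  · ring
  · filter_upwards [self_mem_nhdsWithin] with z hz
    have hz' : z ≠ 0 := hz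
    simp only [slope_def_field, Function.comp, zero_mul, hΨ0, sub_zero]
    rw [hΨ1]
    field_simp

/-- The contribution of the inputs, which enter at second order, to the leading form. -/
theorem tendsto_input_div_sq (hf : f ∈ internalFamilies k) (y : ℝ) (ξ : Fin k → ℝ) (μ : ℝ) :
    Filter.Tendsto (fun z : ℝ => (f (z * y, z ^ 2 • ξ, z * μ) - f (z * y, 0, z * μ)) / z ^ 2)
      (𝓝[≠] 0) (𝓝 (∑ i, dInput f i * ξ i)) := by
  have hs : HasStrictFDerivAt f (fderiv ℝ f 0) 0 :=
    hf.1.contDiffAt.hasStrictFDerivAt (by simp)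
  have ht : Filter.Tendsto (fun z : ℝ => ((z * y, z ^ 2 • ξ, z * μ),
      ((z * y, (0 : Fin k → ℝ), z * μ)))) (𝓝[≠] 0) (𝓝 (0, 0)) := by
    refine Filter.Tendsto.mono_left ?_ nhdsWithin_le_nhds
    have : Continuous (fun z : ℝ => ((z * y, z ^ 2 • ξ, z * μ),
      ((z * y, (0 : Fin k → ℝ), z * μ)))) := by fun_prop
    simpa using! this.tendsto 0
  have h1 := (hs.isLittleO.comp_tendsto ht)
  have h2 : Asymptotics.IsBigO (𝓝[≠] (0 : ℝ)) ((fun q : (ℝ × (Fin k → ℝ) × ℝ) ×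
      (ℝ × (Fin k → ℝ) × ℝ) => q.1 - q.2) ∘ fun z : ℝ => ((z * y, z ^ 2 • ξ, z * μ),
      ((z * y, (0 : Fin k → ℝ), z * μ)))) (fun z : ℝ => z ^ 2) := by
    refine Asymptotics.IsBigO.of_bound ‖ξ‖ (Filter.Eventually.of_forall fun z => ?_)
    have := mul_nonneg (sq_nonneg z) (norm_nonneg ξ)
    simpa [norm_smul, mul_comm] using this
  have h3 := (h1.trans_isBigO h2).tendsto_div_nhds_zero
  have h4 := h3.add_const (∑ i, dInput f i * ξ i)
  rw [zero_add] at h4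
  refine h4.congr' ?_
  filter_upwards [self_mem_nhdsWithin] with z hz
  have hz' : z ≠ 0 := hz
  have h5 : (z * y, z ^ 2 • ξ, z * μ) - (z * y, (0 : Fin k → ℝ), z * μ) =
      z ^ 2 • ((0 : ℝ), ξ, (0 : ℝ)) := by simp
  simp only [Function.comp, h5, map_smul, fderiv_input_eq_sum hf, smul_eq_mul]
  field_simp
  ring

/-- The blow-up: `f` divided by `z ^ 2` along `x₀ = z y`, `x_i = z ^ 2 ξ_i`, `λ = z μ` extends
smoothly to `z = 0`, where it equals the leading form. -/
theorem exists_blowUp (hf : f ∈ internalFamilies k) :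
    ∃ H : (ℝ × (Fin k → ℝ) × ℝ) × ℝ → ℝ, ContDiff ℝ ∞ H ∧
      (∀ y ξ μ z, f (z * y, z ^ 2 • ξ, z * μ) = z ^ 2 * H ((y, ξ, μ), z)) ∧
      ∀ y ξ μ, H ((y, ξ, μ), 0) = leadingForm f y ξ μ := by
  obtain ⟨Ψ, hΨ, hΨ1, hΨ2⟩ := exists_smooth_quotient
    (Φ := fun q : (ℝ × (Fin k → ℝ) × ℝ) × ℝ => f (q.2 * q.1.1, q.2 ^ 2 • q.1.2.1, q.2 * q.1.2.2))
    (hf.1.comp (by fun_prop))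
  have hf0 : f (0, 0, 0) = 0 := hf.2.1 0
  have hΨ0 : ∀ a, Ψ (a, 0) = 0 := by
    intro a
    rw [hΨ2]
    have hd : HasFDerivAt f (fderiv ℝ f 0)
        ((0 : ℝ) * a.1, (0 : ℝ) ^ 2 • a.2.1, (0 : ℝ) * a.2.2) := by
      have h0 : ((0 : ℝ) * a.1, (0 : ℝ) ^ 2 • a.2.1, (0 : ℝ) * a.2.2) = 0 := by
        simp [Prod.ext_iff]
      rw [h0]
      exact (hf.1.differentiable (by simp) 0).hasFDerivAt
    have h2 : HasDerivAt (fun z : ℝ => (z * a.1, z ^ 2 • a.2.1, z * a.2.2)) (a.1, 0, a.2.2) 0 := by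
      refine HasDerivAt.prodMk ?_ (HasDerivAt.prodMk ?_ ?_)
      · simpa using (hasDerivAt_id (0 : ℝ)).mul_const a.1
      · have h3 := (hasDerivAt_pow 2 (0 : ℝ)).smul_const a.2.1
        simpa using! h3
      · simpa using (hasDerivAt_id (0 : ℝ)).mul_const a.2.2
    exact ((hd.comp_hasDerivAt (0 : ℝ) h2).deriv).trans (fderiv_internal_eq_zero hf a.1 a.2.2)
  obtain ⟨H, hH, hH1, -⟩ := exists_smooth_quotient hΨ
  have key : ∀ y ξ μ z, f (z * y, z ^ 2 • ξ, z * μ) = z ^ 2 * H ((y, ξ, μ), z) := by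
    intro y ξ μ z
    have h1 := hΨ1 (y, ξ, μ) z
    have h2 := hH1 (y, ξ, μ) z
    have h3 : f (0 * y, (0 : ℝ) ^ 2 • ξ, 0 * μ) = 0 := by simpa using! hf0
    have h4 : f (z * y, z ^ 2 • ξ, z * μ) = f (0 * y, (0 : ℝ) ^ 2 • ξ, 0 * μ) +
      z * Ψ ((y, ξ, μ), z) := h1
    rw [h4, h3, h2, hΨ0]; ring
  refine ⟨H, hH, key, fun y ξ μ => ?_⟩
  have h1 : Filter.Tendsto (fun z : ℝ => H ((y, ξ, μ), z)) (𝓝[≠] 0) (𝓝 (H ((y, ξ, μ), 0))) :=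
    ((hH.continuous.comp (Continuous.prodMk_right (y, ξ, μ))).tendsto 0).mono_left
      nhdsWithin_le_nhds
  refine tendsto_nhds_unique h1 ?_
  refine ((tendsto_internal_div_sq hf y μ).add (tendsto_input_div_sq hf y ξ μ)).congr' ?_
  filter_upwards [self_mem_nhdsWithin] with z hz
  have hz' : z ≠ 0 := hz
  rw [key]
  field_simp
  ring

end BlowUp

/-! ### Local branches of one equation -/

section LocalBranches

/-- The implicit function theorem for one scalar equation with one parameter, with smoothness on a
whole neighbourhood. -/
theorem exists_implicit_scalar {G : ℝ × ℝ → ℝ} {r : ℝ} (hr : 0 < r)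
    (hG : ContDiffOn ℝ ∞ G (Ioo (-r) r ×ˢ univ)) {y₀ d : ℝ} (h0 : G (0, y₀) = 0)
    (hd : HasDerivAt (fun y => G (0, y)) d y₀) (hd0 : d ≠ 0) :
    ∃ (Y : ℝ → ℝ) (ρ : ℝ), 0 < ρ ∧ ρ ≤ r ∧ ContDiffOn ℝ ∞ Y (Ioo (-ρ) ρ) ∧ Y 0 = y₀ ∧
      (∀ z ∈ Ioo (-ρ) ρ, G (z, Y z) = 0) ∧
      ∃ ε > 0, ∀ z ∈ Ioo (-ρ) ρ, ∀ y, |y - y₀| < ε → G (z, y) = 0 → y = Y z := by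
  have hopen : IsOpen (Ioo (-r) r ×ˢ (univ : Set ℝ)) := isOpen_Ioo.prod isOpen_univ
  have hGat : ∀ z ∈ Ioo (-r) r, ∀ y, ContDiffAt ℝ ∞ G (z, y) := fun z hz y =>
    hG.contDiffAt (hopen.mem_nhds ⟨hz, mem_univ _⟩)
  have hz0 : (0 : ℝ) ∈ Ioo (-r) r := ⟨by linarith, hr⟩
  have hinv : ∀ u : ℝ × ℝ, fderiv ℝ G u (0, 1) ≠ 0 →
      (fderiv ℝ G u ∘L .inr ℝ ℝ ℝ).IsInvertible := by
    intro u hu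
    refine ⟨ContinuousLinearEquiv.unitsEquivAut ℝ (Units.mk0 _ hu), ?_⟩
    ext
    simp
  have hd1 : fderiv ℝ G (0, y₀) (0, 1) = d := by
    have h1 : HasFDerivAt G (fderiv ℝ G (0, y₀)) (0, y₀) :=
      ((hGat 0 hz0 y₀).differentiableAt (by simp)).hasFDerivAt
    have h2 : HasDerivAt (fun y : ℝ => ((0 : ℝ), y)) (0, 1) y₀ :=
      (hasDerivAt_const _ _).prodMk (hasDerivAt_id _)
    exact (HasFDerivAt.comp_hasDerivAt (f := fun y : ℝ => ((0 : ℝ), y)) y₀ h1 h2).unique hd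
  have hu0 : fderiv ℝ G (0, y₀) (0, 1) ≠ 0 := by rwa [hd1]
  have cdf := hGat 0 hz0 y₀
  have hn : (∞ : ℕ∞ω) ≠ 0 := by simp
  set Y := cdf.implicitFunction hn (hinv _ hu0) with hYdef
  have hY0 : Y 0 = y₀ := cdf.implicitFunction_apply_self hn (hinv _ hu0)
  have hYs : ContDiffAt ℝ ∞ Y 0 := cdf.contDiffAt_implicitFunction hn (hinv _ hu0)
  have hYc : ∀ᶠ z in 𝓝 0, ContinuousAt Y z :=
    ((hYs.of_le (m := 1) (by exact_mod_cast le_top)).eventually (by simp)).mono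
      fun z hz => hz.continuousAt
  have hYz : ∀ᶠ z in 𝓝 0, G (z, Y z) = 0 := by
    have := cdf.eventually_apply_implicitFunction hn (hinv _ hu0)
    rw [h0] at this
    exact this
  have hDc : ContinuousAt (fun u => fderiv ℝ G u (0, 1)) (0, y₀) :=
    ((cdf.fderiv_right (m := 0) (by simp)).continuousAt).clm_apply continuousAt_const
  have hgraph : Tendsto (fun z => (z, Y z)) (𝓝 0) (𝓝 (0, y₀)) := by
    have : ContinuousAt (fun z => (z, Y z)) 0 := continuousAt_id.prodMk hYs.continuousAt
    simpa [ContinuousAt, hY0] using! this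
  have hDz : ∀ᶠ z in 𝓝 0, fderiv ℝ G (z, Y z) (0, 1) ≠ 0 :=
    hgraph.eventually (hDc.eventually_ne hu0)
  have hYs' : ∀ᶠ z in 𝓝 0, ContDiffAt ℝ ∞ Y z := by
    filter_upwards [hYc, hYz.eventually_nhds, hDz, isOpen_Ioo.mem_nhds hz0] with z h1 h2 h3 h4
    have c := hGat z h4 (Y z)
    refine (c.contDiffAt_implicitFunction hn (hinv _ h3)).congr_of_eventuallyEq ?_
    have h5 := c.eventually_apply_eq_iff_implicitFunction hn (hinv _ h3)
    have h6 : Tendsto (fun w => (w, Y w)) (𝓝 z) (𝓝 (z, Y z)) := continuousAt_id.prodMk h1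
    filter_upwards [h6.eventually h5, h2] with w hw hw2
    exact (hw.1 (by rw [hw2, h2.self_of_nhds])).symm
  have huniq := cdf.eventually_apply_eq_iff_implicitFunction hn (hinv _ hu0)
  rw [h0, nhds_prod_eq, eventually_prod_iff] at huniq
  obtain ⟨pa, hpa, pb, hpb, hab⟩ := huniq
  obtain ⟨ε, hε, hball⟩ := Metric.eventually_nhds_iff.1 hpb
  obtain ⟨ρ, hρ, hall⟩ := Metric.eventually_nhds_iff.1 (hpa.and (hYs'.and hYz))
  have hall' : ∀ z ∈ Ioo (-(min ρ r)) (min ρ r), pa z ∧ ContDiffAt ℝ ∞ Y z ∧ G (z, Y z) = 0 := by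
    intro z hz
    refine hall ?_
    rw [Real.dist_eq, sub_zero, abs_lt]
    exact ⟨by linarith [hz.1, min_le_left ρ r], by linarith [hz.2, min_le_left ρ r]⟩
  exact ⟨Y, min ρ r, lt_min hρ hr, min_le_right _ _,
    fun z hz => (hall' z hz).2.1.contDiffWithinAt, hY0, fun z hz => (hall' z hz).2.2, ε, hε,
    fun z hz y hy hGy => ((hab (hall' z hz).1 (hball (by rwa [Real.dist_eq]))).1 hGy).symm⟩

variable {k : ℕ} {f : ℝ × (Fin k → ℝ) × ℝ → ℝ}

/-- Every simple root of the leading form extends to a unique smooth local branch of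
`f (z y, z ^ 2 ξ z, z μ z) = 0`. -/
theorem exists_localBranch (hf : f ∈ internalFamilies k) {r : ℝ} (hr : 0 < r)
    {ξ : ℝ → Fin k → ℝ} {μ : ℝ → ℝ} (hξ : ContDiffOn ℝ ∞ ξ (Ioo (-r) r))
    (hμ : ContDiffOn ℝ ∞ μ (Ioo (-r) r)) {y₀ : ℝ} (h0 : leadingForm f y₀ (ξ 0) (μ 0) = 0)
    (h1 : dInternal2 f * y₀ + dInternalParam f * μ 0 ≠ 0) :
    ∃ (Y : ℝ → ℝ) (ρ : ℝ), 0 < ρ ∧ ρ ≤ r ∧ ContDiffOn ℝ ∞ Y (Ioo (-ρ) ρ) ∧ Y 0 = y₀ ∧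
      (∀ z ∈ Ioo (-ρ) ρ, f (z * Y z, z ^ 2 • ξ z, z * μ z) = 0) ∧
      ∃ ε > 0, ∀ z ∈ Ioo (-ρ) ρ, z ≠ 0 → ∀ y, |y - y₀| < ε →
        f (z * y, z ^ 2 • ξ z, z * μ z) = 0 → y = Y z := by
  obtain ⟨H, hH, hfH, hH0⟩ := exists_blowUp hf
  have hG : ContDiffOn ℝ ∞ (fun q : ℝ × ℝ => H ((q.2, ξ q.1, μ q.1), q.1))
      (Ioo (-r) r ×ˢ univ) := by
    have hm : MapsTo Prod.fst (Ioo (-r) r ×ˢ (univ : Set ℝ)) (Ioo (-r) r) := fun q hq => hq.1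
    exact hH.comp_contDiffOn ((contDiffOn_snd.prodMk ((hξ.comp contDiffOn_fst hm).prodMk
      (hμ.comp contDiffOn_fst hm))).prodMk contDiffOn_fst)
  have hd : HasDerivAt (fun y => H ((y, ξ 0, μ 0), 0))
      (dInternal2 f * y₀ + dInternalParam f * μ 0) y₀ := by
    simp only [hH0, leadingForm]
    have h2 := (((hasDerivAt_pow 2 y₀).const_mul (dInternal2 f / 2)).add
      ((hasDerivAt_id' y₀).const_mul (dInternalParam f * μ 0))).add_const
        (∑ i, dInput f i * ξ 0 i)
    refine (h2.congr_deriv ?_)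
    simp; ring
  obtain ⟨Y, ρ, hρ, hρr, hYs, hY0, hYz, ε, hε, huniq⟩ :=
    exists_implicit_scalar hr hG (by simpa [hH0] using h0) hd h1
  refine ⟨Y, ρ, hρ, hρr, hYs, hY0, fun z hz => ?_, ε, hε, fun z hz hz0 y hy hfy => ?_⟩
  · rw [hfH, hYz z hz, mul_zero]
  · rw [hfH] at hfy
    exact huniq z hz y hy ((mul_eq_zero.1 hfy).resolve_left (pow_ne_zero 2 hz0))

/-- A small solution `x z` of `f (x, z ^ 2 ξ z, z μ z) = 0` is of order `z`. -/
theorem eventually_abs_le_of_solution (hf : f ∈ internalFamilies k) (ha : dInternal2 f ≠ 0)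
    {ξ : ℝ → Fin k → ℝ} {μ x : ℝ → ℝ} (hξ : ContinuousAt ξ 0) (hμ : ContinuousAt μ 0)
    (hx : Tendsto x (𝓝[>] 0) (𝓝 0))
    (hsol : ∀ᶠ z in 𝓝[>] 0, f (x z, z ^ 2 • ξ z, z * μ z) = 0) :
    ∃ K, ∀ᶠ z in 𝓝[>] 0, |x z / z| ≤ K := by
  obtain ⟨H, hH, hfH, hH0⟩ := exists_blowUp hf
  -- Here `x` is the scale of the blow-up and `z = x ζ`; at `ζ = 0` the equation has no solution.
  have hc : ContinuousAt (fun q : ℝ × ℝ × (Fin k → ℝ) × ℝ =>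
      H ((1, q.1 ^ 2 • q.2.2.1, q.1 * q.2.2.2), q.2.1)) (0, 0, ξ 0, μ 0) :=
    (hH.continuous.comp (by fun_prop)).continuousAt
  have hne := hc.eventually_ne (y := 0) (by simpa [hH0, leadingForm] using! ha)
  rw [nhds_prod_eq, eventually_prod_iff] at hne
  obtain ⟨pa, hpa, pb, hpb, hab⟩ := hne
  obtain ⟨η, hη, hball⟩ := Metric.eventually_nhds_iff.1 hpa
  have hrest : Tendsto (fun z => (x z, ξ z, μ z)) (𝓝[>] 0) (𝓝 (0, ξ 0, μ 0)) :=
    hx.prodMk_nhds ((hξ.tendsto.mono_left nhdsWithin_le_nhds).prodMk_nhds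
      (hμ.tendsto.mono_left nhdsWithin_le_nhds))
  refine ⟨1 / η, ?_⟩
  filter_upwards [hrest.eventually hpb, hsol, self_mem_nhdsWithin] with z hz hz1 hz2
  have hz3 : 0 < z := hz2
  by_cases hxz : x z = 0
  · simp [hxz, hη.le]
  have h1 : ¬ pa (z / x z) := by
    intro h
    refine hab h hz ?_
    have h2 := hfH 1 ((z / x z) ^ 2 • ξ z) (z / x z * μ z) (x z)
    rw [smul_smul, ← mul_pow, ← mul_assoc, mul_div_cancel₀ _ hxz, mul_one, hz1] at h2
    exact (mul_eq_zero.1 h2.symm).resolve_left (pow_ne_zero 2 hxz)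
  have h2 : η ≤ |z / x z| := by
    by_contra! h
    exact h1 (hball (by rwa [Real.dist_eq, sub_zero]))
  rw [abs_div, abs_of_pos hz3] at h2 ⊢
  have hxp : 0 < |x z| := abs_pos.2 hxz
  rw [le_div_iff₀ hxp] at h2
  rw [div_le_div_iff₀ hz3 hη]
  linarith

/-- A continuous small solution `x z` of `f (x, z ^ 2 ξ z, z μ z) = 0`, `z > 0`, is asymptotic to
`y₀ z` for a root `y₀` of the leading form, provided the leading form has no double root. -/
theorem exists_tendsto_div_of_solution (hf : f ∈ internalFamilies k) (ha : dInternal2 f ≠ 0)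
    {ξ : ℝ → Fin k → ℝ} {μ x : ℝ → ℝ} (hξ : ContinuousAt ξ 0) (hμ : ContinuousAt μ 0)
    {r : ℝ} (hr : 0 < r) (hxc : ContinuousOn x (Ioo 0 r))
    (hx : Tendsto x (𝓝[>] 0) (𝓝 0))
    (hsol : ∀ᶠ z in 𝓝[>] 0, f (x z, z ^ 2 • ξ z, z * μ z) = 0)
    (hD : (dInternalParam f * μ 0) ^ 2 - 2 * dInternal2 f * ∑ i, dInput f i * ξ 0 i ≠ 0) :
    ∃ y₀, leadingForm f y₀ (ξ 0) (μ 0) = 0 ∧ dInternal2 f * y₀ + dInternalParam f * μ 0 ≠ 0 ∧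
      Tendsto (fun z => x z / z) (𝓝[>] 0) (𝓝 y₀) := by
  obtain ⟨K, hK⟩ := eventually_abs_le_of_solution hf ha hξ hμ hx hsol
  obtain ⟨H, hH, hfH, hH0⟩ := exists_blowUp hf
  set a := dInternal2 f with ha_def
  set b := dInternalParam f with hb_def
  set A := ∑ i, dInput f i * ξ 0 i with hA
  have hlead : ∀ y, 2 * a * leadingForm f y (ξ 0) (μ 0) =
      (a * y + b * μ 0) ^ 2 - ((b * μ 0) ^ 2 - 2 * a * A) := by
    intro y; simp only [leadingForm, ← ha_def, ← hb_def, ← hA]; ring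
  set D := (b * μ 0) ^ 2 - 2 * a * A with hDdef
  have hQ : Tendsto (fun z => leadingForm f (x z / z) (ξ 0) (μ 0)) (𝓝[>] 0) (𝓝 0) := by
    rw [Metric.tendsto_nhds]
    intro ε hε
    have hcomp := (isCompact_Icc (a := -K) (b := K)).eventually_forall_of_forall_eventually
      (x₀ := (0 : ℝ)) (P := fun z y => |H ((y, ξ z, μ z), z) - H ((y, ξ 0, μ 0), 0)| < ε) ?_
    · filter_upwards [hK, hsol, nhdsWithin_le_nhds hcomp, self_mem_nhdsWithin] with z h1 h2 h3 h4
      have hz : z ≠ 0 := ne_of_gt h4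
      have h5 := h3 (x z / z) (abs_le.1 h1)
      have h6 := hfH (x z / z) (ξ z) (μ z) z
      rw [mul_div_cancel₀ _ hz, h2] at h6
      rw [(mul_eq_zero.1 h6.symm).resolve_left (pow_ne_zero 2 hz), hH0, zero_sub, abs_neg] at h5
      rwa [Real.dist_eq, sub_zero]
    · intro y _
      have h1 : ContinuousAt (fun q : ℝ × ℝ => H ((q.2, ξ q.1, μ q.1), q.1)) (0, y) := by
        refine hH.continuous.continuousAt.comp ?_
        have h2 : ContinuousAt (fun q : ℝ × ℝ => ξ q.1) (0, y) :=
          ContinuousAt.comp (f := Prod.fst) (g := ξ) hξ continuousAt_fst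
        have h3 : ContinuousAt (fun q : ℝ × ℝ => μ q.1) (0, y) :=
          ContinuousAt.comp (f := Prod.fst) (g := μ) hμ continuousAt_fst
        exact (continuousAt_snd.prodMk (h2.prodMk h3)).prodMk continuousAt_fst
      have h2 : ContinuousAt (fun q : ℝ × ℝ => H ((q.2, ξ 0, μ 0), 0)) (0, y) :=
        (hH.continuous.comp (by fun_prop)).continuousAt
      have h3 := (h1.sub h2).abs
      refine h3.eventually_lt_const ?_
      simpa using hε
  have hg : Tendsto (fun z => (a * (x z / z) + b * μ 0) ^ 2) (𝓝[>] 0) (𝓝 D) := by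
    have h1 := (hQ.const_mul (2 * a)).add_const D
    rw [mul_zero, zero_add] at h1
    refine h1.congr fun z => ?_
    rw [hlead]; ring
  have hDpos : 0 < D :=
    lt_of_le_of_ne (ge_of_tendsto' hg fun z => sq_nonneg _) (Ne.symm hD)
  have hgabs : Tendsto (fun z => |a * (x z / z) + b * μ 0|) (𝓝[>] 0) (𝓝 (√D)) := by
    refine (hg.sqrt).congr fun z => Real.sqrt_sq_eq_abs _
  have hgne : ∀ᶠ z in 𝓝[>] 0, a * (x z / z) + b * μ 0 ≠ 0 := by
    filter_upwards [hg.eventually_const_lt hDpos] with z hz h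
    simp [h] at hz
  obtain ⟨ρ, hρ, hgρ⟩ := mem_nhdsGT_iff_exists_Ioo_subset.1 hgne
  have hρ0 : (0 : ℝ) < min ρ r := lt_min hρ hr
  have hcont : ContinuousOn (fun z => a * (x z / z) + b * μ 0) (Ioo 0 (min ρ r)) :=
    (continuousOn_const.mul ((hxc.mono (Ioo_subset_Ioo_right (min_le_right _ _))).div
      continuousOn_id fun z hz => ne_of_gt hz.1)).add continuousOn_const
  have hne : ∀ z ∈ Ioo 0 (min ρ r), a * (x z / z) + b * μ 0 ≠ 0 := fun z hz =>
    hgρ ⟨hz.1, hz.2.trans_le (min_le_left _ _)⟩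
  have hmem : Ioo 0 (min ρ r) ∈ 𝓝[>] (0 : ℝ) := Ioo_mem_nhdsGT hρ0
  -- The sign of the derivative of the leading form is constant along a branch.
  have hsign : (∀ z ∈ Ioo 0 (min ρ r), 0 < a * (x z / z) + b * μ 0) ∨
      (∀ z ∈ Ioo 0 (min ρ r), a * (x z / z) + b * μ 0 < 0) := by
    by_contra! h
    obtain ⟨⟨z1, hz1, h1⟩, z2, hz2, h2⟩ := h
    obtain ⟨z, hz, hz0⟩ := isPreconnected_Ioo.intermediate_value hz1 hz2 hcont ⟨h1, h2⟩
    exact hne z hz hz0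
  have hfinish : ∀ s : ℝ, s ^ 2 = D → Tendsto (fun z => a * (x z / z) + b * μ 0) (𝓝[>] 0) (𝓝 s) →
      ∃ y₀, leadingForm f y₀ (ξ 0) (μ 0) = 0 ∧ a * y₀ + b * μ 0 ≠ 0 ∧
        Tendsto (fun z => x z / z) (𝓝[>] 0) (𝓝 y₀) := by
    intro s hs ht
    have hay : a * ((s - b * μ 0) / a) + b * μ 0 = s := by field_simp; ring
    refine ⟨(s - b * μ 0) / a, ?_, ?_, ?_⟩
    · have := hlead ((s - b * μ 0) / a)
      rw [hay, hs, sub_self] at this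
      simpa [ha] using this
    · rw [hay]; rintro rfl; simp at hs; exact hD hs.symm
    · refine ((ht.sub_const (b * μ 0)).div_const a).congr fun z => ?_
      field_simp; ring
  rcases hsign with h | h
  · refine hfinish (√D) (Real.sq_sqrt hDpos.le) (hgabs.congr' ?_)
    filter_upwards [hmem] with z hz using abs_of_pos (h z hz)
  · refine hfinish (-√D) (by rw [neg_sq, Real.sq_sqrt hDpos.le]) (hgabs.neg.congr' ?_)
    filter_upwards [hmem] with z hz
    rw [abs_of_neg (h z hz), neg_neg]

end LocalBranches

/-! ### The generic set of coefficients -/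

/-- The functions of the coefficients that can occur as slopes of square-root-order `q`: the slopes
of order `q + 1` are the two square roots prescribed by a nonempty set `I` of inputs with slopes of
order `q`.  The absolute value under the root makes the functions independent of the side of `0`. -/
def slopeFamily (k : ℕ) : ℕ → Set ((Fin k → ℝ) × ℝ × ℝ → ℝ)
  | 0 => {fun x => -(2 * x.2.2 / x.2.1)}
  | q + 1 => {g | ∃ (I : Finset (Fin k)) (t : Fin k → (Fin k → ℝ) × ℝ × ℝ → ℝ), I.Nonempty ∧
      (∀ i, t i ∈ slopeFamily k q) ∧
      ((g = fun x => √|2 / x.2.1 * ∑ i ∈ I, x.1 i * t i x|) ∨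
        (g = fun x => -√|2 / x.2.1 * ∑ i ∈ I, x.1 i * t i x|))}

/-- The coefficients for which no slope of order at most `m` vanishes and the cells of the first
layer have a nondegenerate linearisation. -/
def genericCoefficients (k m : ℕ) : Set ((Fin k → ℝ) × ℝ × ℝ) :=
  {x | x.2.1 ≠ 0 ∧ x.2.2 ≠ 0 ∧ ∑ i, x.1 i ≠ 0 ∧ ∀ q ≤ m, ∀ t ∈ slopeFamily k q, t x ≠ 0}

theorem finite_slopeFamily (k q : ℕ) : (slopeFamily k q).Finite := by
  induction q with
  | zero => exact Set.finite_singleton _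
  | succ q ih =>
    have h1 : (Set.univ.pi fun _ : Fin k => slopeFamily k q).Finite := Set.Finite.pi fun _ => ih
    have h2 := (Set.finite_univ (α := Finset (Fin k))).prod h1
    refine ((h2.image fun w x => √|2 / x.2.1 * ∑ i ∈ w.1, x.1 i * w.2 i x|).union
      (h2.image fun w x => -√|2 / x.2.1 * ∑ i ∈ w.1, x.1 i * w.2 i x|)).subset ?_
    rintro g ⟨I, t, -, ht, hg | hg⟩
    · exact Or.inl ⟨(I, t), ⟨Set.mem_univ _, fun i _ => ht i⟩, hg.symm⟩
    · exact Or.inr ⟨(I, t), ⟨Set.mem_univ _, fun i _ => ht i⟩, hg.symm⟩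

theorem continuousOn_of_mem_slopeFamily {k q : ℕ} {t : (Fin k → ℝ) × ℝ × ℝ → ℝ}
    (ht : t ∈ slopeFamily k q) : ContinuousOn t {x | x.2.1 ≠ 0} := by
  induction q generalizing t with
  | zero =>
    rw [slopeFamily, Set.mem_singleton_iff] at ht
    subst ht
    exact (ContinuousOn.div (by fun_prop) (by fun_prop) fun x hx => hx).neg
  | succ q ih =>
    obtain ⟨I, t, -, ht, h⟩ := ht
    have h1 : ContinuousOn (fun x : (Fin k → ℝ) × ℝ × ℝ =>
        √|2 / x.2.1 * ∑ i ∈ I, x.1 i * t i x|) {x | x.2.1 ≠ 0} := by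
      refine (((ContinuousOn.div (by fun_prop) (by fun_prop) fun x hx => hx).mul
        (continuousOn_finsetSum _ fun i _ => ?_)).abs).sqrt
      exact ContinuousOn.mul (by fun_prop) (ih (ht i))
    rcases h with rfl | rfl
    exacts [h1, h1.neg]

theorem isOpen_genericCoefficients (k m : ℕ) : IsOpen (genericCoefficients k m) := by
  have hU : IsOpen {x : (Fin k → ℝ) × ℝ × ℝ | x.2.1 ≠ 0} :=
    isOpen_ne_fun (by fun_prop) (by fun_prop)
  have h1 : IsOpen {x : (Fin k → ℝ) × ℝ × ℝ | x.2.2 ≠ 0} :=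
    isOpen_ne_fun (by fun_prop) (by fun_prop)
  have h2 : IsOpen {x : (Fin k → ℝ) × ℝ × ℝ | ∑ i, x.1 i ≠ 0} :=
    isOpen_ne_fun (by fun_prop) (by fun_prop)
  have h3 : IsOpen (⋂ q ∈ Set.Iic m, ⋂ t ∈ slopeFamily k q,
      ({x : (Fin k → ℝ) × ℝ × ℝ | x.2.1 ≠ 0} ∩ t ⁻¹' {0}ᶜ)) :=
    (Set.finite_Iic m).isOpen_biInter fun q _ => (finite_slopeFamily k q).isOpen_biInter
      fun t ht => (continuousOn_of_mem_slopeFamily ht).isOpen_inter_preimage hU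
        isOpen_compl_singleton
  convert hU.inter (h1.inter (h2.inter h3)) using 1
  ext x
  simp only [genericCoefficients, Set.mem_ofPred_eq, Set.mem_inter_iff, Set.mem_iInter,
    Set.mem_Iic, Set.mem_preimage, Set.mem_compl_iff, Set.mem_singleton_iff]
  grind

/-! ### Density of the generic set, by a `3`-adic valuation -/

/-- Uniqueness of base-`B` expansions with `k` digits. -/
theorem ofDigits_injective {k B : ℕ} {β γ : Fin k → ℕ} (hβ : ∀ i, β i < B) (hγ : ∀ i, γ i < B)
    (h : ∑ i, β i * B ^ (i : ℕ) = ∑ i, γ i * B ^ (i : ℕ)) : β = γ := by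
  have h1 : (fun i => (⟨β i, hβ i⟩ : Fin B)) = fun i => ⟨γ i, hγ i⟩ := by
    apply finFunctionFinEquiv.injective
    apply Fin.ext
    simpa [finFunctionFinEquiv_apply] using h
  funext i
  simpa using congrFun h1 i

/-- Weak approximation: rational numbers of prescribed `3`-adic absolute value are dense in `ℝ`.
Those of the form `3 ^ n (3 j + 1) / 2 ^ N` suffice. -/
theorem dense_padic_norm_eq (n : ℕ) :
    Dense {x : ℝ | ∃ q : ℚ, (q : ℝ) = x ∧ ‖(q : ℚ_[3])‖ = (1 / 3) ^ n} := by
  rw [dense_iff_exists_between]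
  intro x y hxy
  obtain ⟨N, hN⟩ := pow_unbounded_of_one_lt (3 ^ (n + 1) / (y - x)) (one_lt_two (α := ℝ))
  have hyx : 0 < y - x := sub_pos.2 hxy
  have h3 : (0 : ℝ) < 3 ^ n := by positivity
  have h2 : (0 : ℝ) < 2 ^ N := by positivity
  rw [div_lt_iff₀ hyx, pow_succ] at hN
  set X := x * 2 ^ N / 3 ^ n with hX
  set j : ℤ := ⌊(X - 1) / 3⌋ + 1 with hj
  have hj1 : (X - 1) / 3 < j := by rw [hj]; push_cast; exact Int.lt_floor_add_one _
  have hj2 : (j : ℝ) ≤ (X - 1) / 3 + 1 := by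
    rw [hj]; push_cast; linarith [Int.floor_le ((X - 1) / 3)]
  have hX1 : X * 3 ^ n = x * 2 ^ N := by rw [hX]; field_simp
  refine ⟨((3 ^ n * (3 * j + 1 : ℤ) / 2 ^ N : ℚ) : ℝ), ⟨_, rfl, ?_⟩, ?_, ?_⟩
  · have hn2 : ‖(2 : ℚ_[3])‖ = 1 := by
      have h := Padic.norm_intCast_lt_one_iff (p := 3) (k := 2)
      have h' := Padic.norm_int_le_one (p := 3) 2
      push_cast at h h'
      exact le_antisymm h' (not_lt.1 fun hh => by have := h.1 hh; omega)
    have hn1 : ‖((3 * j + 1 : ℤ) : ℚ_[3])‖ = 1 := by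
      have h := Padic.norm_intCast_lt_one_iff (p := 3) (k := (3 * j + 1))
      have h' := Padic.norm_int_le_one (p := 3) (3 * j + 1)
      exact le_antisymm h' (not_lt.1 fun hh => by have := h.1 hh; omega)
    have hn3 : ‖(3 : ℚ_[3])‖ = 1 / 3 := by
      have := Padic.norm_p (p := 3)
      simpa using this
    rw [Rat.cast_div, Rat.cast_mul, Rat.cast_pow, Rat.cast_pow, Rat.cast_intCast, norm_div,
      norm_mul, norm_pow, norm_pow, hn1]
    simp [hn2, hn3]
  · push_cast
    rw [lt_div_iff₀ h2]
    nlinarith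
  · push_cast
    rw [div_lt_iff₀ h2]
    nlinarith

/-- In a nonarchimedean field, a nonempty sum of terms of pairwise distinct norms has the norm of
one of its terms. -/
theorem exists_norm_sum_eq_of_injOn {ι F : Type*} [NormedField F]
    [IsUltrametricDist F] {I : Finset ι} (hI : I.Nonempty) {g : ι → F}
    (hg : ∀ i ∈ I, ∀ j ∈ I, ‖g i‖ = ‖g j‖ → i = j) (h0 : ∀ i ∈ I, g i ≠ 0) :
    ∃ i ∈ I, ‖∑ j ∈ I, g j‖ = ‖g i‖ := by
  classical
  obtain ⟨i, hi, hmax⟩ := I.exists_max_image (fun i => ‖g i‖) hI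
  refine ⟨i, hi, ?_⟩
  rw [← Finset.add_sum_erase I g hi]
  have hlt : ‖∑ j ∈ I.erase i, g j‖ < ‖g i‖ := by
    rcases (I.erase i).eq_empty_or_nonempty with h | h
    · simpa [h] using h0 i hi
    · have : Nonempty ι := ⟨i⟩
      obtain ⟨j, hj, hle⟩ := IsUltrametricDist.exists_norm_finsetSum_le (I.erase i) g
      have hj' := hj h
      rw [Finset.mem_erase] at hj'
      exact hle.trans_lt (lt_of_le_of_ne (hmax j hj'.2) fun h => hj'.1 (hg j hj'.2 i hi h))
  rw [IsUltrametricDist.norm_add_eq_max_of_norm_ne_norm hlt.ne', max_eq_left hlt.le]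

/-- At rational coefficients with sufficiently independent `3`-adic valuations, all slopes have a
finite `3`-adic valuation: the terms of each sum under a root have pairwise distinct norms, because
the exponent of the `i`-th term has a large `i`-th digit in base `2 ^ m`. -/
theorem padic_norm_slope {k m : ℕ}
    (φ : algebraicClosure ℚ ℝ →ₐ[ℚ] PadicAlgCl 3) {r : Fin k → ℚ} {a b : ℚ}
    (hr : ∀ i, ‖(r i : ℚ_[3])‖ = (1 / 3) ^ (2 ^ m) ^ (i : ℕ))
    (ha : ‖(a : ℚ_[3])‖ = 1) (hb : ‖(b : ℚ_[3])‖ = 1) {q : ℕ} (hq : q ≤ m)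
    {t : (Fin k → ℝ) × ℝ × ℝ → ℝ} (ht : t ∈ slopeFamily k q) :
    ∃ y : algebraicClosure ℚ ℝ, (y : ℝ) = t (fun i => (r i : ℝ), (a : ℝ), (b : ℝ)) ∧
      ∃ α : Fin k → ℕ, (∀ i, α i < 2 ^ q) ∧
        ‖φ y‖ ^ 2 ^ q = (1 / 3) ^ ∑ i, α i * (2 ^ m) ^ (i : ℕ) := by
  have hφ : ∀ c : ℚ, ‖φ (c : algebraicClosure ℚ ℝ)‖ = ‖(c : ℚ_[3])‖ := by
    intro c
    have h1 : φ (c : algebraicClosure ℚ ℝ) = ((c : ℚ_[3]) : PadicAlgCl 3) := by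
      rw [map_ratCast]; exact (map_ratCast (algebraMap ℚ_[3] (PadicAlgCl 3)) c).symm
    rw [h1, PadicAlgCl.norm_extends]
  have h2 : ‖φ (2 : algebraicClosure ℚ ℝ)‖ = 1 := by
    have h := hφ 2
    have h' := Padic.norm_intCast_lt_one_iff (p := 3) (k := 2)
    have h'' := Padic.norm_int_le_one (p := 3) 2
    push_cast at h h' h''
    rw [h]
    exact le_antisymm h'' (not_lt.1 fun hh => by have := h'.1 hh; omega)
  induction q generalizing t with
  | zero =>
    rw [slopeFamily, Set.mem_singleton_iff] at ht
    subst ht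
    -- Order `0`: the slope is a `3`-adic unit, so all digits of the exponent are `0`.
    refine ⟨-(2 * b / a), by push_cast; rfl, 0, by simp, ?_⟩
    simp [map_neg, map_div₀, map_mul, hφ, ha, hb, h2, -map_ratCast]
  | succ q ih =>
    obtain ⟨I, t', hI, ht', h⟩ := ht
    choose y hy α hα hαn using fun i => ih (by omega) (ht' i)
    set S : algebraicClosure ℚ ℝ := ∑ i ∈ I, (r i : algebraicClosure ℚ ℝ) * y i with hS
    have hSr : (S : ℝ) = ∑ i ∈ I, (r i : ℝ) * t' i (fun i => (r i : ℝ), (a : ℝ), (b : ℝ)) := by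
      rw [hS]; push_cast
      exact Finset.sum_congr rfl fun i _ => by rw [hy]
    -- The digits of the exponent of the `i`-th term; only the `i`-th of them can reach `2 ^ q`.
    set β : Fin k → Fin k → ℕ := fun i j => α i j + if j = i then 2 ^ q else 0 with hβ
    have hβlt : ∀ i j, β i j < 2 ^ (q + 1) := by
      intro i j
      have := hα i j
      simp only [hβ, pow_succ]
      split_ifs <;> omega
    have hterm : ∀ i, ‖φ ((r i : algebraicClosure ℚ ℝ) * y i)‖ ^ 2 ^ q =
        (1 / 3) ^ ∑ j, β i j * (2 ^ m) ^ (j : ℕ) := by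
      intro i
      rw [map_mul, norm_mul, mul_pow, hφ, hr, hαn, ← pow_mul, ← pow_add]
      congr 1
      simp only [hβ, add_mul, Finset.sum_add_distrib, ite_mul, zero_mul, Finset.sum_ite_eq',
        Finset.mem_univ, if_true]
      ring
    obtain ⟨i, hi, hnorm⟩ := exists_norm_sum_eq_of_injOn hI
      (g := fun i => φ ((r i : algebraicClosure ℚ ℝ) * y i)) (by
        intro i _ j _ hij
        have h3 := hterm i
        rw [hij, hterm j] at h3
        have h4 := pow_right_injective₀ (a := (1 / 3 : ℝ)) (by norm_num) (by norm_num) h3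
        have hB : 2 ^ (q + 1) ≤ 2 ^ m := Nat.pow_le_pow_right (by norm_num) hq
        have h5 := ofDigits_injective (fun l => (hβlt j l).trans_le hB)
          (fun l => (hβlt i l).trans_le hB) h4
        by_contra hne
        have h6 := congrFun h5 i
        have h7 := hα j i
        simp [hβ, hne] at h6
        omega) (by
        intro i _ h0
        have h3 := hterm i
        rw [h0, norm_zero, zero_pow (by positivity)] at h3
        exact (by positivity : (1 / 3 : ℝ) ^ (∑ j, β i j * (2 ^ m) ^ (j : ℕ)) ≠ 0) h3.symm)
    rw [← map_sum] at hnorm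
    have hg : ∃ ε : ℝ, (t (fun i => (r i : ℝ), (a : ℝ), (b : ℝ))) ^ 2 = ε * (2 / a * S) ∧
        (ε = 1 ∨ ε = -1) := by
      have h3 : (t (fun i => (r i : ℝ), (a : ℝ), (b : ℝ))) ^ 2 = |2 / (a : ℝ) * (S : ℝ)| := by
        rw [hSr]
        rcases h with rfl | rfl <;> simp only [neg_sq] <;> exact Real.sq_sqrt (abs_nonneg _)
      rcases abs_choice (2 / (a : ℝ) * S) with h4 | h4
      · exact ⟨1, by rw [h3, h4, one_mul], Or.inl rfl⟩
      · exact ⟨-1, by rw [h3, h4, neg_one_mul], Or.inr rfl⟩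
    obtain ⟨ε, hε, hε'⟩ := hg
    have halg : IsAlgebraic ℚ (t (fun i => (r i : ℝ), (a : ℝ), (b : ℝ))) := by
      refine IsAlgebraic.of_pow (n := 2) (by norm_num) ?_
      have h3 : IsAlgebraic ℚ ((2 / a * S : algebraicClosure ℚ ℝ) : ℝ) :=
        mem_algebraicClosure_iff.1 (2 / a * S : algebraicClosure ℚ ℝ).2
      push_cast at h3
      rw [hε]
      rcases hε' with rfl | rfl
      · rwa [one_mul]
      · rw [neg_one_mul]; exact h3.neg
    refine ⟨⟨_, mem_algebraicClosure_iff.2 halg⟩, rfl, β i, hβlt i, ?_⟩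
    have h3 : ‖φ ⟨_, mem_algebraicClosure_iff.2 halg⟩‖ ^ 2 = ‖φ S‖ := by
      rw [← norm_pow, ← map_pow]
      have h4 : (⟨_, mem_algebraicClosure_iff.2 halg⟩ : algebraicClosure ℚ ℝ) ^ 2 = 2 / a * S ∨
          (⟨_, mem_algebraicClosure_iff.2 halg⟩ : algebraicClosure ℚ ℝ) ^ 2 = -(2 / a * S) := by
        rcases hε' with rfl | rfl
        · left; apply Subtype.ext; push_cast; rw [hε, one_mul]; rfl
        · right; apply Subtype.ext; push_cast; rw [hε, neg_one_mul]; rfl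
      rcases h4 with h4 | h4 <;> rw [h4] <;>
        simp [map_neg, map_div₀, map_mul, hφ, ha, h2, -map_ratCast]
    rw [pow_succ', pow_mul, h3, ← hterm i, hnorm]

theorem dense_genericCoefficients (k m : ℕ) (hk : 0 < k) : Dense (genericCoefficients k m) := by
  have : Algebra.IsAlgebraic ℚ (algebraicClosure ℚ ℝ) := algebraicClosure.isAlgebraic ℚ ℝ
  let φ : algebraicClosure ℚ ℝ →ₐ[ℚ] PadicAlgCl 3 := IsAlgClosed.lift
  have h1 : Dense ((Set.univ.pi fun i : Fin k =>
      {x : ℝ | ∃ q : ℚ, (q : ℝ) = x ∧ ‖(q : ℚ_[3])‖ = (1 / 3) ^ (2 ^ (m + 1)) ^ (i : ℕ)}) ×ˢ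
      ({x : ℝ | ∃ q : ℚ, (q : ℝ) = x ∧ ‖(q : ℚ_[3])‖ = (1 / 3) ^ 0} ×ˢ
        {x : ℝ | ∃ q : ℚ, (q : ℝ) = x ∧ ‖(q : ℚ_[3])‖ = (1 / 3) ^ 0})) :=
    (dense_pi Set.univ fun i _ => dense_padic_norm_eq _).prod
      ((dense_padic_norm_eq 0).prod (dense_padic_norm_eq 0))
  refine h1.mono ?_
  rintro ⟨c, a, b⟩ ⟨hc, ⟨a, rfl, ha⟩, ⟨b, rfl, hb⟩⟩
  choose r hrc hr using fun i => hc i (Set.mem_univ i)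
  obtain rfl : (fun i => (r i : ℝ)) = c := funext hrc
  rw [pow_zero] at ha hb
  refine ⟨?_, ?_, ?_, fun q hq t ht h0 => ?_⟩
  · rintro h
    rw [Rat.cast_eq_zero.1 h] at ha
    simp at ha
  · rintro h
    rw [Rat.cast_eq_zero.1 h] at hb
    simp at hb
  · intro h
    have h2 : ((∑ i, r i : ℚ) : ℝ) = 0 := by push_cast; exact h
    have h0 : ∀ i, (r i : ℚ_[3]) ≠ 0 := by
      intro i h0
      have := hr i
      rw [h0, norm_zero] at this
      exact (by positivity : (1 / 3 : ℝ) ^ (2 ^ (m + 1)) ^ (i : ℕ) ≠ 0) this.symm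
    have : Nonempty (Fin k) := ⟨⟨0, hk⟩⟩
    obtain ⟨i, -, hi⟩ := exists_norm_sum_eq_of_injOn (Finset.univ_nonempty (α := Fin k))
      (g := fun i => (r i : ℚ_[3])) (fun i _ j _ hij => by
        rw [hr, hr] at hij
        have h3 := pow_right_injective₀ (a := (1 / 3 : ℝ)) (by norm_num) (by norm_num) hij
        have h4 : 2 ≤ 2 ^ (m + 1) := Nat.le_self_pow (by omega) 2
        exact Fin.ext (Nat.pow_right_injective h4 h3)) (fun i _ => h0 i)
    rw [← Rat.cast_sum, Rat.cast_eq_zero.1 h2, Rat.cast_zero, norm_zero] at hi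
    exact h0 i (norm_eq_zero.1 hi.symm)
  · obtain ⟨y, hy, α, -, hα⟩ := padic_norm_slope φ hr ha hb (hq.trans m.le_succ) ht
    have hy0 : y = 0 := Subtype.ext (hy.trans h0)
    rw [hy0, map_zero, norm_zero, zero_pow (by positivity)] at hα
    exact (by positivity : (1 / 3 : ℝ) ^ (∑ j, α j * (2 ^ (m + 1)) ^ (j : ℕ)) ≠ 0) hα.symm

/-! ### Square-root-orders and slopes -/

theorem signType_mul_self {τ : SignType} (hτ : τ ≠ 0) : (τ : ℝ) * τ = 1 := by
  cases τ <;> simp_all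

theorem signType_cast_ne_zero {τ : SignType} (hτ : τ ≠ 0) : (τ : ℝ) ≠ 0 := by
  cases τ <;> simp_all

theorem mem_domainSet_iff {τ : SignType} (hτ : τ ≠ 0) {r l : ℝ} :
    l ∈ domainSet τ r ↔ l = τ * |l| ∧ |l| < r := by
  cases τ with
  | zero => exact absurd rfl hτ
  | pos =>
    simp only [domainSet, mem_Ico, SignType.pos_eq_one, SignType.coe_one, one_mul]
    constructor
    · rintro ⟨h1, h2⟩; rw [abs_of_nonneg h1]; exact ⟨rfl, h2⟩
    · rintro ⟨h1, h2⟩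
      exact ⟨by rw [h1]; exact abs_nonneg _, (le_abs_self l).trans_lt h2⟩
  | neg =>
    simp only [domainSet, mem_Ioc, SignType.neg_eq_neg_one, SignType.coe_neg_one, neg_one_mul]
    constructor
    · rintro ⟨h1, h2⟩; rw [abs_of_nonpos h2]; exact ⟨by ring, by linarith⟩
    · rintro ⟨h1, h2⟩
      have := abs_nonneg l
      exact ⟨by linarith, by linarith⟩

theorem abs_signType_mul {τ : SignType} (hτ : τ ≠ 0) {t : ℝ} (ht : 0 ≤ t) :
    |(τ : ℝ) * t| = t := by
  cases τ <;> simp_all [abs_of_nonneg]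

theorem signType_mul_mem_domainSet {τ : SignType} (hτ : τ ≠ 0) {r t : ℝ} (ht : 0 ≤ t)
    (htr : t < r) : (τ : ℝ) * t ∈ domainSet τ r := by
  rw [mem_domainSet_iff hτ, abs_signType_mul hτ ht]
  exact ⟨rfl, htr⟩

theorem pow_rpow_inv_two_pow {z : ℝ} (hz : 0 ≤ z) (q : ℕ) :
    (z ^ 2 ^ q) ^ ((1 : ℝ) / 2 ^ q) = z := by
  have := Real.pow_rpow_inv_natCast hz (n := 2 ^ q) (by positivity)
  rw [one_div]; exact_mod_cast this

theorem rpow_inv_two_pow_pow {t : ℝ} (ht : 0 ≤ t) (q : ℕ) :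
    (t ^ ((1 : ℝ) / 2 ^ q)) ^ 2 ^ q = t := by
  have := Real.rpow_inv_natCast_pow ht (n := 2 ^ q) (by positivity)
  rw [one_div]; exact_mod_cast this

theorem tendsto_pow_nhdsGE {n : ℕ} (hn : n ≠ 0) :
    Tendsto (fun z : ℝ => z ^ n) (𝓝[≥] 0) (𝓝[≥] 0) := by
  refine tendsto_nhdsWithin_iff.2 ⟨?_, ?_⟩
  · have : Tendsto (fun z : ℝ => z ^ n) (𝓝 0) (𝓝 (0 ^ n)) := (continuous_pow n).tendsto 0
    rw [zero_pow hn] at this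
    exact this.mono_left nhdsWithin_le_nhds
  · filter_upwards [self_mem_nhdsWithin] with z hz
    exact pow_nonneg (mem_Ici.1 hz) n

theorem tendsto_pow_nhdsGT {n : ℕ} (hn : n ≠ 0) :
    Tendsto (fun z : ℝ => z ^ n) (𝓝[>] 0) (𝓝[>] 0) := by
  refine tendsto_nhdsWithin_iff.2 ⟨?_, ?_⟩
  · have : Tendsto (fun z : ℝ => z ^ n) (𝓝 0) (𝓝 (0 ^ n)) := (continuous_pow n).tendsto 0
    rw [zero_pow hn] at this
    exact this.mono_left nhdsWithin_le_nhds
  · filter_upwards [self_mem_nhdsWithin] with z hz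
    exact pow_pos (mem_Ioi.1 hz) n

theorem tendsto_root_nhdsGE (q : ℕ) :
    Tendsto (fun t : ℝ => t ^ ((1 : ℝ) / 2 ^ q)) (𝓝[≥] 0) (𝓝[≥] 0) := by
  have hq : (0 : ℝ) < 1 / 2 ^ q := by positivity
  refine tendsto_nhdsWithin_iff.2 ⟨?_, ?_⟩
  · have : Tendsto (fun t : ℝ => t ^ ((1 : ℝ) / 2 ^ q)) (𝓝 0) (𝓝 (0 ^ ((1 : ℝ) / 2 ^ q))) :=
      (Real.continuous_rpow_const hq.le).tendsto 0
    rw [Real.zero_rpow hq.ne'] at this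
    exact this.mono_left nhdsWithin_le_nhds
  · filter_upwards [self_mem_nhdsWithin] with z hz
    exact Real.rpow_nonneg hz _

theorem eventually_nhdsGE_iff {P : ℝ → Prop} :
    (∀ᶠ t in 𝓝[≥] (0 : ℝ), P t) ↔ ∃ r > 0, ∀ t, 0 ≤ t → t < r → P t := by
  rw [Filter.Eventually, mem_nhdsGE_iff_exists_Ico_subset]
  exact ⟨fun ⟨r, hr, h⟩ => ⟨r, hr, fun t h0 h1 => h ⟨h0, h1⟩⟩,
    fun ⟨r, hr, h⟩ => ⟨r, hr, fun t ht => h t ht.1 ht.2⟩⟩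

/-- A scalar germ of square-root-order `q` and slope `s` satisfies `u l ∼ τ s |l| ^ (2 ^ (-q))`. -/
theorem HasRootForm.tendsto {τ : SignType} (hτ : τ ≠ 0) {u : ℝ → ℝ} {q : ℕ} {s : ℝ}
    (h : HasRootForm τ u q s) :
    Tendsto (fun z : ℝ => u (τ * z ^ 2 ^ q) / z) (𝓝[>] 0) (𝓝 (τ * s)) := by
  obtain ⟨-, r, hr, v, -, huv, ht⟩ := h
  have h1 : Tendsto (fun z : ℝ => (τ : ℝ) * z) (𝓝[>] 0) (𝓝[domainSet τ r \ {0}] 0) := by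
    refine tendsto_nhdsWithin_iff.2 ⟨?_, ?_⟩
    · have : Tendsto (fun z : ℝ => (τ : ℝ) * z) (𝓝 0) (𝓝 (τ * 0)) :=
        (continuous_const_mul _).tendsto 0
      rw [mul_zero] at this
      exact this.mono_left nhdsWithin_le_nhds
    · filter_upwards [Ioo_mem_nhdsGT hr] with z hz
      exact ⟨signType_mul_mem_domainSet hτ hz.1.le hz.2,
        mul_ne_zero (signType_cast_ne_zero hτ) hz.1.ne'⟩
  refine ((ht.comp h1).const_mul (τ : ℝ)).congr' ?_
  have hq : (2 ^ q : ℕ) ≠ 0 := by positivity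
  filter_upwards [(tendsto_pow_nhdsGT hq).eventually (Ioo_mem_nhdsGT hr), self_mem_nhdsWithin]
    with z hz hz0
  have hz0 : 0 < z := hz0
  rw [huv _ (signType_mul_mem_domainSet hτ hz.1.le hz.2), abs_signType_mul hτ hz.1.le,
    pow_rpow_inv_two_pow hz0.le]
  simp only [Function.comp, abs_signType_mul hτ hz0.le]
  have := signType_cast_ne_zero hτ
  field_simp

/-- A germ of exact order `|l| ^ (2 ^ (-q))` cannot have a finite leading coefficient, zero or
not, on the faster scale `|l| ^ (2 ^ (-q'))` with `q' < q`. -/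
theorem not_tendsto_lower_root {τ : SignType} {u : ℝ → ℝ} {q q' : ℕ} {A A' : ℝ} (hA : A ≠ 0)
    (h : Tendsto (fun z : ℝ => u (τ * z ^ 2 ^ q) / z) (𝓝[>] 0) (𝓝 A)) (hq : q' < q)
    (h' : Tendsto (fun z : ℝ => u (τ * z ^ 2 ^ q') / z) (𝓝[>] 0) (𝓝 A')) : False := by
  obtain ⟨d, rfl⟩ := Nat.exists_eq_add_of_lt hq
  have hd : (2 ^ (d + 1) : ℕ) ≠ 0 := by positivity
  have hd1 : (2 ^ (d + 1) - 1 : ℕ) ≠ 0 := by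
    have : 2 ≤ 2 ^ (d + 1) := Nat.le_self_pow (by omega) 2
    omega
  have h1 := h'.comp (tendsto_pow_nhdsGT hd)
  have h2 : Tendsto (fun z : ℝ => z ^ (2 ^ (d + 1) - 1)) (𝓝[>] 0) (𝓝 0) :=
    (tendsto_pow_nhdsGT hd1).mono_right nhdsWithin_le_nhds
  have h3 := h1.mul h2
  rw [mul_zero] at h3
  refine hA (tendsto_nhds_unique (h.congr' ?_) h3)
  filter_upwards [self_mem_nhdsWithin] with z hz
  have hz0 : z ≠ 0 := ne_of_gt hz
  have h4 : z ^ 2 ^ (d + 1) = z ^ (2 ^ (d + 1) - 1) * z := by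
    rw [← pow_succ]; congr 1; omega
  simp only [Function.comp]
  rw [← pow_mul, ← pow_add, show d + 1 + q' = q' + d + 1 by ring, div_mul_eq_mul_div, h4]
  field_simp

theorem HasOrderAndSlope.unique {τ : SignType} (hτ : τ ≠ 0) {u : ℝ → ℝ} {p p' : ℤ} {s s' : ℝ}
    (h : HasOrderAndSlope τ u p s) (h' : HasOrderAndSlope τ u p' s') : p = p' ∧ s = s' := by
  have hzero : ∀ {q : ℕ} {s : ℝ}, HasRootForm τ u q s →
      ¬ ∃ r : ℝ, 0 < r ∧ ∀ l ∈ domainSet τ r, u l = 0 := by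
    rintro q s hq ⟨r, hr, h0⟩
    refine mul_ne_zero (signType_cast_ne_zero hτ) hq.1 (tendsto_nhds_unique (hq.tendsto hτ) ?_)
    refine tendsto_const_nhds.congr' ?_
    have hq0 : (2 ^ q : ℕ) ≠ 0 := by positivity
    filter_upwards [(tendsto_pow_nhdsGT hq0).eventually (Ioo_mem_nhdsGT hr)] with z hz
    rw [h0 _ (signType_mul_mem_domainSet hτ hz.1.le hz.2), zero_div]
  rcases h with ⟨rfl, rfl, h0⟩ | ⟨q, rfl, hq, -⟩ <;>
    rcases h' with ⟨rfl, rfl, h0'⟩ | ⟨q', rfl, hq', -⟩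
  · exact ⟨rfl, rfl⟩
  · exact absurd h0 (hzero hq')
  · exact absurd h0' (hzero hq)
  · have hne := signType_cast_ne_zero hτ
    rcases lt_trichotomy q q' with hlt | rfl | hlt
    · exact (not_tendsto_lower_root (mul_ne_zero hne hq'.1) (hq'.tendsto hτ) hlt
        (hq.tendsto hτ)).elim
    · exact ⟨rfl, mul_left_cancel₀ hne (tendsto_nhds_unique (hq.tendsto hτ) (hq'.tendsto hτ))⟩
    · exact (not_tendsto_lower_root (mul_ne_zero hne hq.1) (hq.tendsto hτ) hlt
        (hq'.tendsto hτ)).elim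

/-- The form in which the components of branches are constructed and classified: with
`|l| = z ^ (2 ^ q)`, the component is `z Y(z)` with `Y` smooth on both sides of `0` and
`Y 0 = τ s`; the order `-1` stands for a germ that vanishes. -/
def HasBranchForm (τ : SignType) (u : ℝ → ℝ) (p : ℤ) (s : ℝ) : Prop :=
  (p = -1 ∧ s = 0 ∧ ∀ᶠ t in 𝓝[≥] (0 : ℝ), u (τ * t) = 0) ∨
  (∃ q : ℕ, p = q ∧ s ≠ 0 ∧ ∃ (Y : ℝ → ℝ) (r : ℝ), 0 < r ∧ ContDiffOn ℝ ∞ Y (Ioo (-r) r) ∧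
    Y 0 = τ * s ∧ ∀ᶠ z in 𝓝[≥] (0 : ℝ), u (τ * z ^ 2 ^ q) = z * Y z)

theorem HasBranchForm.congr {τ : SignType} {u u' : ℝ → ℝ} {p : ℤ} {s : ℝ}
    (h : HasBranchForm τ u p s) (hu : ∀ᶠ t in 𝓝[≥] (0 : ℝ), u (τ * t) = u' (τ * t)) :
    HasBranchForm τ u' p s := by
  rcases h with ⟨hp, hs, h0⟩ | ⟨q, hp, hs, Y, r, hr, hY, hY0, h0⟩
  · refine Or.inl ⟨hp, hs, ?_⟩
    filter_upwards [h0, hu] with t h1 h2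
    rw [← h2, h1]
  · refine Or.inr ⟨q, hp, hs, Y, r, hr, hY, hY0, ?_⟩
    have hq0 : (2 ^ q : ℕ) ≠ 0 := by positivity
    filter_upwards [h0, (tendsto_pow_nhdsGE hq0).eventually hu] with z h1 h2
    rw [← h2, h1]

theorem continuousAt_zero_of_contDiffOn {E : Type*} [NormedAddCommGroup E] [NormedSpace ℝ E]
    {Y : ℝ → E} {r : ℝ} (hr : 0 < r) (hY : ContDiffOn ℝ ∞ Y (Ioo (-r) r)) : ContinuousAt Y 0 :=
  hY.continuousOn.continuousAt (Ioo_mem_nhds (by linarith) hr)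

theorem HasBranchForm.tendsto {τ : SignType} {u : ℝ → ℝ} {q : ℕ} {s : ℝ}
    (h : HasBranchForm τ u q s) :
    Tendsto (fun z : ℝ => u (τ * z ^ 2 ^ q) / z) (𝓝[>] 0) (𝓝 (τ * s)) := by
  rcases h with ⟨hp, -⟩ | ⟨q', hp, -, Y, r, hr, hY, hY0, h0⟩
  · exact absurd hp (by omega)
  · obtain rfl : q = q' := by exact_mod_cast hp
    rw [← hY0]
    refine ((continuousAt_zero_of_contDiffOn hr hY).tendsto.mono_left
      nhdsWithin_le_nhds).congr' ?_
    filter_upwards [self_mem_nhdsWithin, nhdsWithin_mono 0 Ioi_subset_Ici_self h0] with z hz h1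
    have hz0 : z ≠ 0 := ne_of_gt hz
    rw [h1]
    field_simp

theorem HasBranchForm.hasOrderAndSlope {τ : SignType} (hτ : τ ≠ 0) {u : ℝ → ℝ} {p : ℤ} {s : ℝ}
    (h : HasBranchForm τ u p s) : HasOrderAndSlope τ u p s := by
  have hform := h
  rcases h with ⟨hp, hs, h0⟩ | ⟨q, rfl, hs, Y, r, hr, hY, hY0, h0⟩
  · obtain ⟨r, hr, h1⟩ := eventually_nhdsGE_iff.1 h0
    refine Or.inl ⟨hp, hs, r, hr, fun l hl => ?_⟩
    rw [mem_domainSet_iff hτ] at hl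
    rw [hl.1]
    exact h1 _ (abs_nonneg l) hl.2
  · have hne := signType_cast_ne_zero hτ
    refine Or.inr ⟨q, rfl, ⟨hs, ?_⟩, fun q' hq' s' h' => not_tendsto_lower_root
      (mul_ne_zero hne hs) hform.tendsto hq' (h'.tendsto hτ)⟩
    obtain ⟨ρ, hρ, h1⟩ := eventually_nhdsGE_iff.1 h0
    set ε := min ρ r with hε
    have hε0 : 0 < ε := lt_min hρ hr
    have hεq : (ε ^ 2 ^ q) ^ ((1 : ℝ) / 2 ^ q) = ε := pow_rpow_inv_two_pow hε0.le q
    refine ⟨ε ^ 2 ^ q, by positivity, fun z => z * Y z, ?_, fun l hl => ?_, ?_⟩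
    · rw [hεq]
      refine contDiffOn_id.mul (hY.mono fun z hz => ⟨by linarith [hz.1], ?_⟩)
      exact hz.2.trans_le (min_le_right _ _)
    · rw [mem_domainSet_iff hτ] at hl
      have h2 : |l| ^ ((1 : ℝ) / 2 ^ q) < ε := by
        rw [← hεq]
        exact Real.rpow_lt_rpow (abs_nonneg l) hl.2 (by positivity)
      have h3 := h1 _ (Real.rpow_nonneg (abs_nonneg l) _) (h2.trans_le (min_le_left _ _))
      rw [rpow_inv_two_pow_pow (abs_nonneg l), ← hl.1] at h3
      exact h3
    · have h2 : Tendsto (fun l : ℝ => (τ : ℝ) * Y |l|) (𝓝[domainSet τ (ε ^ 2 ^ q) \ {0}] 0)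
          (𝓝 (τ * Y |0|)) := by
        refine Tendsto.const_mul _ (Tendsto.mono_left ?_ nhdsWithin_le_nhds)
        refine ContinuousAt.comp (f := fun l : ℝ => |l|) (g := Y) ?_ continuous_abs.continuousAt
        rw [abs_zero]
        exact continuousAt_zero_of_contDiffOn hr hY
      rw [abs_zero, hY0, ← mul_assoc, signType_mul_self hτ, one_mul] at h2
      refine h2.congr' ?_
      filter_upwards [self_mem_nhdsWithin] with l hl
      have hl1 := (mem_domainSet_iff hτ).1 hl.1
      have hl0 : l ≠ 0 := hl.2
      have hl2 : |l| ≠ 0 := abs_ne_zero.2 hl0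
      have h4 : |l| * Y |l| / l = |l| * Y |l| / (τ * |l|) := by rw [← hl1.1]
      rw [h4]
      field_simp
      rw [sq, signType_mul_self hτ, one_mul]

theorem HasBranchForm.unique {τ : SignType} (hτ : τ ≠ 0) {u : ℝ → ℝ} {p p' : ℤ} {s s' : ℝ}
    (h : HasBranchForm τ u p s) (h' : HasBranchForm τ u p' s') : p = p' ∧ s = s' :=
  (h.hasOrderAndSlope hτ).unique hτ (h'.hasOrderAndSlope hτ)

theorem HasBranchForm.order_eq_neg_one_iff {τ : SignType} {u : ℝ → ℝ} {p : ℤ} {s : ℝ}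
    (h : HasBranchForm τ u p s) : p = -1 ↔ s = 0 := by
  rcases h with ⟨hp, hs, -⟩ | ⟨q, rfl, hs, -⟩
  · simp [hp, hs]
  · simp [hs]

/-- On the scale of order `q`, germs of lower order are of second order, and only those of order
`q - 1` contribute to the leading coefficient. -/
theorem HasBranchForm.exists_rescale {τ : SignType} {u : ℝ → ℝ} {p : ℤ} {s : ℝ}
    (h : HasBranchForm τ u p s) {q : ℕ} (hq : p < q) :
    ∃ (ξ : ℝ → ℝ) (r : ℝ), 0 < r ∧ ContDiffOn ℝ ∞ ξ (Ioo (-r) r) ∧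
      ξ 0 = (if p = q - 1 then τ * s else 0) ∧
      ∀ᶠ z in 𝓝[≥] (0 : ℝ), u (τ * z ^ 2 ^ q) = z ^ 2 * ξ z := by
  rcases h with ⟨rfl, rfl, h0⟩ | ⟨q', rfl, hs, Y, r, hr, hY, hY0, h0⟩
  · refine ⟨fun _ => 0, 1, one_pos, contDiffOn_const, by simp, ?_⟩
    have hq0 : (2 ^ q : ℕ) ≠ 0 := by positivity
    filter_upwards [(tendsto_pow_nhdsGE hq0).eventually h0] with z hz
    rw [hz, mul_zero]
  · have hq' : q' < q := by exact_mod_cast hq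
    obtain ⟨d, rfl⟩ := Nat.exists_eq_add_of_lt hq'
    have hd : (2 ^ (d + 1) : ℕ) ≠ 0 := by positivity
    have hd2 : 2 ≤ 2 ^ (d + 1) := Nat.le_self_pow (by omega) 2
    refine ⟨fun z => z ^ (2 ^ (d + 1) - 2) * Y (z ^ 2 ^ (d + 1)), min r 1, lt_min hr one_pos,
      ?_, ?_, ?_⟩
    · refine (contDiff_id.pow _).contDiffOn.mul
        (hY.comp (contDiff_id.pow _).contDiffOn fun z hz => ?_)
      have h1 : |z| < min r 1 := abs_lt.2 hz
      have h2 : |z ^ 2 ^ (d + 1)| < r := by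
        rw [abs_pow]
        calc |z| ^ 2 ^ (d + 1) ≤ |z| ^ 1 := pow_le_pow_of_le_one (abs_nonneg z)
              (h1.le.trans (min_le_right _ _)) (Nat.one_le_iff_ne_zero.2 hd)
          _ < r := by rw [pow_one]; exact h1.trans_le (min_le_left _ _)
      exact abs_lt.1 h2
    · simp only [zero_pow hd, hY0]
      rcases Nat.eq_zero_or_pos d with rfl | hd0
      · simp
      · have h3 : 2 ^ (d + 1) - 2 ≠ 0 := by
          have : 2 ^ 2 ≤ 2 ^ (d + 1) := Nat.pow_le_pow_right (by omega) (by omega)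
          omega
        rw [zero_pow h3, zero_mul, if_neg]
        push_cast
        omega
    · filter_upwards [(tendsto_pow_nhdsGE hd).eventually h0] with z hz
      rw [← pow_mul, ← pow_add, show d + 1 + q' = q' + d + 1 by ring] at hz
      rw [hz, ← mul_assoc, ← pow_add]
      congr 2
      omega

/-- Components in branch form are continuous up to `0` and smooth away from `0`. -/
theorem HasBranchForm.regular {τ : SignType} (hτ : τ ≠ 0) {u : ℝ → ℝ} {p : ℤ} {s : ℝ}
    (h : HasBranchForm τ u p s) : ∀ᶠ r in 𝓝[>] (0 : ℝ), ContinuousOn u (domainSet τ r) ∧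
      ContDiffOn ℝ ∞ u (interior (domainSet τ r)) := by
  rcases h with ⟨-, -, h0⟩ | ⟨q, -, -, Y, r, hr, hY, -, h0⟩
  · obtain ⟨ρ, hρ, h1⟩ := eventually_nhdsGE_iff.1 h0
    filter_upwards [Ioo_mem_nhdsGT hρ] with r hr
    have h2 : ∀ l ∈ domainSet τ r, u l = 0 := by
      intro l hl
      rw [mem_domainSet_iff hτ] at hl
      rw [hl.1]
      exact h1 _ (abs_nonneg l) (hl.2.trans hr.2)
    exact ⟨continuousOn_const.congr h2, contDiffOn_const.congr fun l hl =>
      h2 l (interior_subset hl)⟩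
  · obtain ⟨ρ, hρ, h1⟩ := eventually_nhdsGE_iff.1 h0
    have hev : ∀ᶠ t in 𝓝[≥] (0 : ℝ), t ^ ((1 : ℝ) / 2 ^ q) < min ρ r :=
      (tendsto_root_nhdsGE q).eventually
        (mem_nhdsWithin_of_mem_nhds (Iio_mem_nhds (lt_min hρ hr)))
    obtain ⟨σ, hσ, h2⟩ := eventually_nhdsGE_iff.1 hev
    filter_upwards [Ioo_mem_nhdsGT hσ] with r' hr'
    have hbd : ∀ l ∈ domainSet τ r', |l| ^ ((1 : ℝ) / 2 ^ q) < min ρ r := fun l hl =>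
      h2 _ (abs_nonneg l) (((mem_domainSet_iff hτ).1 hl).2.trans hr'.2)
    have h3 : ∀ l ∈ domainSet τ r',
        u l = |l| ^ ((1 : ℝ) / 2 ^ q) * Y (|l| ^ ((1 : ℝ) / 2 ^ q)) := by
      intro l hl
      have h4 := h1 _ (Real.rpow_nonneg (abs_nonneg l) _)
        ((hbd l hl).trans_le (min_le_left _ _))
      rw [rpow_inv_two_pow_pow (abs_nonneg l), ← ((mem_domainSet_iff hτ).1 hl).1] at h4
      exact h4
    have hmaps : MapsTo (fun l : ℝ => |l| ^ ((1 : ℝ) / 2 ^ q)) (domainSet τ r') (Ioo (-r) r) := by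
      intro l hl
      have h5 := Real.rpow_nonneg (abs_nonneg l) ((1 : ℝ) / 2 ^ q)
      exact ⟨by linarith, (hbd l hl).trans_le (min_le_right _ _)⟩
    constructor
    · have h6 : ContinuousOn (fun l : ℝ => |l| ^ ((1 : ℝ) / 2 ^ q)) (domainSet τ r') :=
        ((Real.continuous_rpow_const (by positivity)).comp continuous_abs).continuousOn
      exact (h6.mul (hY.continuousOn.comp h6 hmaps)).congr h3
    · have h7 : ∀ l ∈ interior (domainSet τ r'), l ≠ 0 := by
        cases τ with
        | zero => exact absurd rfl hτ
        | pos => intro l hl; simp only [domainSet, interior_Ico] at hl; exact hl.1.ne'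
        | neg => intro l hl; simp only [domainSet, interior_Ioc] at hl; exact hl.2.ne
      have h6 : ContDiffOn ℝ ∞ (fun l : ℝ => |l| ^ ((1 : ℝ) / 2 ^ q))
          (interior (domainSet τ r')) := fun l hl =>
        ((contDiffAt_abs (h7 l hl)).rpow_const_of_ne
          (abs_ne_zero.2 (h7 l hl))).contDiffWithinAt
      exact (h6.mul (hY.comp h6 (hmaps.mono_left interior_subset))).congr fun l hl =>
        h3 l (interior_subset hl)

/-! ### The equation of a single cell -/

section Cell

variable {k : ℕ} {f : ℝ × (Fin k → ℝ) × ℝ → ℝ}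

/-- The radicand in the condition on the slope of a cell of order `p` whose inputs have orders `P`
and slopes `S`. -/
def cellRadicand (f : ℝ × (Fin k → ℝ) × ℝ → ℝ) (δ : SignType) (p : ℤ) (P : Fin k → ℤ)
    (S : Fin k → ℝ) : ℝ :=
  -(2 * (δ : ℝ) / dInternal2 f) *
    ∑ i ∈ Finset.univ.filter (fun i : Fin k => P i = p - 1), dInput f i * S i

/-- The conditions that admissible data satisfy at one cell of order `p` and slope `s` whose inputs
have orders `P` and slopes `S`. -/
structure CellConditions (f : ℝ × (Fin k → ℝ) × ℝ → ℝ) (δ : SignType) (p : ℤ) (s : ℝ)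
    (P : Fin k → ℤ) (S : Fin k → ℝ) : Prop where
  neg_one_le : -1 ≤ p
  input_of_eq_neg_one : p = -1 → ∀ i, P i = -1
  input_of_neg_one_lt : -1 < p → (∀ i, P i ≤ p - 1) ∧ ∃ i, P i = p - 1
  eq_neg_one_iff : p = -1 ↔ s = 0
  slope_of_eq_zero : p = 0 → s = -(2 * dInternalParam f / dInternal2 f)
  slope_of_pos : 0 < p → 0 ≤ cellRadicand f δ p P S ∧
    (s = √(cellRadicand f δ p P S) ∨ s = -√(cellRadicand f δ p P S))

theorem mem_admissibleData_iff {C : Type*} {N : Network C k} {δ : SignType} {p : C → ℤ}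
    {s : C → ℝ} : (δ, p, s) ∈ admissibleData N f ↔ (δ = 0 ↔ ∀ c, p c ≤ 0) ∧
      ∀ c, CellConditions f δ (p c) (s c) (fun i => p (N.input i c))
        (fun i => s (N.input i c)) := by
  constructor
  · rintro ⟨h1, h2, h3, h4, h5, h6, h7⟩
    exact ⟨h2, fun c => ⟨h1 c, h3 c, h4 c, h5 c, h6 c, h7 c⟩⟩
  · rintro ⟨h, hc⟩
    exact ⟨fun c => (hc c).1, h, fun c => (hc c).2, fun c => (hc c).3, fun c => (hc c).4,
      fun c => (hc c).5, fun c => (hc c).6⟩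

theorem eventually_nhdsGE_of_nhdsGT {Q : ℝ → Prop} (h0 : Q 0) (h : ∀ᶠ z in 𝓝[>] (0 : ℝ), Q z) :
    ∀ᶠ z in 𝓝[≥] (0 : ℝ), Q z := by
  rw [← Ioi_insert, nhdsWithin_insert, eventually_sup]
  exact ⟨by simpa using h0, h⟩

theorem exists_rescale_inputs {τ : SignType} {u : Fin k → ℝ → ℝ} {P : Fin k → ℤ} {S : Fin k → ℝ}
    (h : ∀ i, HasBranchForm τ (u i) (P i) (S i)) {q : ℕ} (hq : ∀ i, P i < q) :
    ∃ (ξ : ℝ → Fin k → ℝ) (r : ℝ), 0 < r ∧ ContDiffOn ℝ ∞ ξ (Ioo (-r) r) ∧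
      (ξ 0 = fun i => if P i = q - 1 then τ * S i else 0) ∧
      ∀ᶠ z in 𝓝[≥] (0 : ℝ), (fun i => u i (τ * z ^ 2 ^ q)) = z ^ 2 • ξ z := by
  choose ξ r hr hξ hξ0 hu using fun i => (h i).exists_rescale (hq i)
  have h1 : ∀ᶠ ρ in 𝓝[>] (0 : ℝ), ∀ i, ρ < r i :=
    eventually_all.2 fun i => mem_nhdsWithin_of_mem_nhds (Iio_mem_nhds (hr i))
  obtain ⟨ρ, hρ, hρ0⟩ := (h1.and self_mem_nhdsWithin).exists
  refine ⟨fun z i => ξ i z, ρ, hρ0, contDiffOn_pi.2 fun i => (hξ i).mono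
    (Ioo_subset_Ioo (by linarith [hρ i]) (hρ i).le), funext hξ0, ?_⟩
  filter_upwards [eventually_all.2 hu] with z hz
  funext i
  simp [hz i]

theorem rescaled_param (τ : SignType) (q : ℕ) (z : ℝ) :
    z * (τ * z ^ (2 ^ q - 1)) = τ * z ^ 2 ^ q := by
  have : 1 ≤ 2 ^ q := Nat.one_le_two_pow
  rw [mul_left_comm, ← pow_succ', Nat.sub_add_cancel this]

/-- On the scale of order `q`, the parameter is of first order only if `q = 0`. -/
theorem rescaled_param_zero (τ : SignType) (q : ℕ) :
    (τ : ℝ) * 0 ^ (2 ^ q - 1) = if q = 0 then (τ : ℝ) else 0 := by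
  rcases Nat.eq_zero_or_pos q with rfl | hq0
  · simp
  · have : 2 ≤ 2 ^ q := Nat.le_self_pow (by omega) 2
    rw [zero_pow (by omega), mul_zero, if_neg (by omega)]

/-- A simple root `y₀` of the leading form of a cell of order `q` gives a smooth solution of its
equation, which is the only one near `y₀`. -/
theorem exists_cell_branch (hf : f ∈ internalFamilies k) {τ : SignType} {u : Fin k → ℝ → ℝ}
    {P : Fin k → ℤ} {S : Fin k → ℝ} (h : ∀ i, HasBranchForm τ (u i) (P i) (S i)) {q : ℕ}
    (hq : ∀ i, P i < q) {y₀ : ℝ}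
    (h0 : leadingForm f y₀ (fun i => if P i = q - 1 then τ * S i else 0)
      (if q = 0 then (τ : ℝ) else 0) = 0)
    (h1 : dInternal2 f * y₀ + dInternalParam f * (if q = 0 then (τ : ℝ) else 0) ≠ 0) :
    ∃ (Y : ℝ → ℝ) (ρ : ℝ), 0 < ρ ∧ ContDiffOn ℝ ∞ Y (Ioo (-ρ) ρ) ∧ Y 0 = y₀ ∧
      (∀ᶠ z in 𝓝[≥] (0 : ℝ),
        f (z * Y z, (fun i => u i (τ * z ^ 2 ^ q)), τ * z ^ 2 ^ q) = 0) ∧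
      ∃ ε > 0, ∀ᶠ z in 𝓝[>] (0 : ℝ), ∀ y, |y - y₀| < ε →
        f (z * y, (fun i => u i (τ * z ^ 2 ^ q)), τ * z ^ 2 ^ q) = 0 → y = Y z := by
  obtain ⟨ξ, r, hr, hξ, hξ0, hu⟩ := exists_rescale_inputs h hq
  have hμ : ContDiff ℝ ∞ (fun z : ℝ => (τ : ℝ) * z ^ (2 ^ q - 1)) :=
    contDiff_const.mul (contDiff_id.pow _)
  have hμ0 := rescaled_param_zero τ q
  have hμz := rescaled_param τ q
  rw [← hξ0, ← hμ0] at h0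
  rw [← hμ0] at h1
  obtain ⟨Y, ρ, hρ, -, hY, hY0, hsol, ε, hε, huniq⟩ :=
    exists_localBranch hf hr hξ hμ.contDiffOn h0 h1
  simp only [hμz] at hsol huniq
  refine ⟨Y, ρ, hρ, hY, hY0, ?_, ε, hε, ?_⟩
  · filter_upwards [hu, Ico_mem_nhdsGE hρ] with z hz hzρ
    rw [hz]
    exact hsol z ⟨by linarith [hzρ.1], hzρ.2⟩
  · filter_upwards [nhdsWithin_mono 0 Ioi_subset_Ici_self hu, Ioo_mem_nhdsGT hρ] with z hz hzρ
    rw [hz]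
    exact huniq z ⟨by linarith [hzρ.1], hzρ.2⟩ hzρ.1.ne'

theorem sum_leading_inputs {τ : SignType} {P : Fin k → ℤ} {S : Fin k → ℝ} (q : ℕ) :
    ∑ i, dInput f i * (if P i = q - 1 then τ * S i else 0) =
      τ * ∑ i ∈ Finset.univ.filter (fun i : Fin k => P i = q - 1), dInput f i * S i := by
  rw [Finset.sum_filter, Finset.mul_sum]
  refine Finset.sum_congr rfl fun i _ => ?_
  split_ifs <;> ring

/-- The conditions on the slope of a cell say that it is a simple root of the leading form. -/
theorem CellConditions.simple_root {τ : SignType} (hτ : τ ≠ 0) (ha : dInternal2 f ≠ 0)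
    (hb : dInternalParam f ≠ 0) {q : ℕ} {s : ℝ} {P : Fin k → ℤ} {S : Fin k → ℝ}
    (hS : ∀ i, P i = -1 → S i = 0) (h : CellConditions f τ q s P S) :
    leadingForm f (τ * s) (fun i => if P i = q - 1 then τ * S i else 0)
      (if q = 0 then (τ : ℝ) else 0) = 0 ∧
    dInternal2 f * (τ * s) + dInternalParam f * (if q = 0 then (τ : ℝ) else 0) ≠ 0 := by
  have hττ := signType_mul_self hτ
  have hτ0 := signType_cast_ne_zero hτ
  rw [leadingForm, sum_leading_inputs]
  rcases Nat.eq_zero_or_pos q with rfl | hq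
  · have hs := h.slope_of_eq_zero (by simp)
    have hsum : ∑ i ∈ Finset.univ.filter (fun i : Fin k => P i = (0 : ℕ) - 1),
        dInput f i * S i = 0 := by
      refine Finset.sum_eq_zero fun i hi => ?_
      rw [hS i (by simpa using hi), mul_zero]
    rw [hsum, hs]
    simp only [if_true]
    constructor
    · field_simp; ring
    · field_simp
      exact mul_ne_zero (mul_ne_zero hτ0 hb) (by norm_num)
  · have hq' : (0 : ℤ) < q := by exact_mod_cast hq
    obtain ⟨h1, h2⟩ := h.slope_of_pos hq'
    have hs0 : s ≠ 0 := fun hs => by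
      have := h.eq_neg_one_iff.2 hs
      omega
    have h3 : s ^ 2 = cellRadicand f τ q P S := by
      rcases h2 with h2 | h2 <;> rw [h2] <;> simp [Real.sq_sqrt h1]
    rw [if_neg hq.ne', mul_pow, h3, cellRadicand, sq, hττ]
    constructor
    · field_simp; ring
    · rw [mul_zero, add_zero]
      exact mul_ne_zero ha (mul_ne_zero hτ0 hs0)

/-- Inputs of order `-1` vanish together near `0`. -/
theorem HasBranchForm.input_eq_zero {τ : SignType} {u : Fin k → ℝ → ℝ}
    {P : Fin k → ℤ} {S : Fin k → ℝ} (h : ∀ i, HasBranchForm τ (u i) (P i) (S i))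
    (hP : ∀ i, P i = -1) : ∀ᶠ t in 𝓝[≥] (0 : ℝ), (fun i => u i (τ * t)) = 0 := by
  have h1 : ∀ i, ∀ᶠ t in 𝓝[≥] (0 : ℝ), u i (τ * t) = 0 := by
    intro i
    rcases h i with ⟨-, -, h0⟩ | ⟨q, hp, -⟩
    · exact h0
    · rw [hP i] at hp; omega
  filter_upwards [eventually_all.2 h1] with t ht
  exact funext ht

/-- The cell equation has a solution for all data satisfying the conditions. -/
theorem exists_cell_solution (hf : f ∈ internalFamilies k) (ha : dInternal2 f ≠ 0)
    (hb : dInternalParam f ≠ 0) {τ : SignType} (hτ : τ ≠ 0) {u : Fin k → ℝ → ℝ}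
    {P : Fin k → ℤ} {S : Fin k → ℝ} (h : ∀ i, HasBranchForm τ (u i) (P i) (S i)) {p : ℤ} {s : ℝ}
    (hc : CellConditions f τ p s P S) :
    ∃ v : ℝ → ℝ, HasBranchForm τ v p s ∧
      ∀ᶠ t in 𝓝[≥] (0 : ℝ), f (v (τ * t), (fun i => u i (τ * t)), τ * t) = 0 := by
  rcases hc.neg_one_le.eq_or_lt with hp | hp
  · refine ⟨fun _ => 0, Or.inl ⟨hp.symm, hc.eq_neg_one_iff.1 hp.symm, by simp⟩, ?_⟩
    filter_upwards [HasBranchForm.input_eq_zero h (hc.input_of_eq_neg_one hp.symm)] with t ht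
    rw [ht]
    exact hf.2.1 _
  · obtain ⟨q, rfl⟩ := Int.eq_ofNat_of_zero_le (by omega : 0 ≤ p)
    have hroot := hc.simple_root hτ ha hb fun i => (h i).order_eq_neg_one_iff.1
    have hq : ∀ i, P i < q := fun i => by have := (hc.input_of_neg_one_lt hp).1 i; omega
    obtain ⟨Y, ρ, hρ, hY, hY0, hsol, -⟩ := exists_cell_branch hf h hq hroot.1 hroot.2
    have hs : s ≠ 0 := fun hs => by have := hc.eq_neg_one_iff.2 hs; omega
    refine ⟨fun l => |l| ^ ((1 : ℝ) / 2 ^ q) * Y (|l| ^ ((1 : ℝ) / 2 ^ q)),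
      Or.inr ⟨q, rfl, hs, Y, ρ, hρ, hY, hY0, ?_⟩, ?_⟩
    · filter_upwards [self_mem_nhdsWithin] with z hz
      rw [abs_signType_mul hτ (pow_nonneg (mem_Ici.1 hz) _), pow_rpow_inv_two_pow (mem_Ici.1 hz)]
    · filter_upwards [(tendsto_root_nhdsGE q).eventually hsol, self_mem_nhdsWithin] with t ht ht0
      rw [rpow_inv_two_pow_pow (mem_Ici.1 ht0)] at ht
      rwa [abs_signType_mul hτ (mem_Ici.1 ht0)]

/-- Order and slope determine a solution of the cell equation. -/
theorem cell_solution_unique (hf : f ∈ internalFamilies k) (ha : dInternal2 f ≠ 0)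
    (hb : dInternalParam f ≠ 0) {τ : SignType} (hτ : τ ≠ 0) {u : Fin k → ℝ → ℝ}
    {P : Fin k → ℤ} {S : Fin k → ℝ} (h : ∀ i, HasBranchForm τ (u i) (P i) (S i)) {p : ℤ} {s : ℝ}
    (hc : CellConditions f τ p s P S) {v v' : ℝ → ℝ} (hv : HasBranchForm τ v p s)
    (hv' : HasBranchForm τ v' p s)
    (hsol : ∀ᶠ t in 𝓝[≥] (0 : ℝ), f (v (τ * t), (fun i => u i (τ * t)), τ * t) = 0)
    (hsol' : ∀ᶠ t in 𝓝[≥] (0 : ℝ), f (v' (τ * t), (fun i => u i (τ * t)), τ * t) = 0) :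
    ∀ᶠ t in 𝓝[≥] (0 : ℝ), v (τ * t) = v' (τ * t) := by
  rcases hc.neg_one_le.eq_or_lt with hp | hp
  · rcases hv with ⟨-, -, h0⟩ | ⟨q, hp', -⟩
    · rcases hv' with ⟨-, -, h0'⟩ | ⟨q, hp', -⟩
      · filter_upwards [h0, h0'] with t h1 h2
        rw [h1, h2]
      · omega
    · omega
  · obtain ⟨q, rfl⟩ := Int.eq_ofNat_of_zero_le (by omega : 0 ≤ p)
    have hroot := hc.simple_root hτ ha hb fun i => (h i).order_eq_neg_one_iff.1
    have hq : ∀ i, P i < q := fun i => by have := (hc.input_of_neg_one_lt hp).1 i; omega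
    have hq0 : (2 ^ q : ℕ) ≠ 0 := by positivity
    obtain ⟨Y, ρ, hρ, hY, hY0, -, ε, hε, huniq⟩ := exists_cell_branch hf h hq hroot.1 hroot.2
    have key : ∀ w : ℝ → ℝ, HasBranchForm τ w q s →
        (∀ᶠ t in 𝓝[≥] (0 : ℝ), f (w (τ * t), (fun i => u i (τ * t)), τ * t) = 0) →
        ∀ᶠ z in 𝓝[≥] (0 : ℝ), w (τ * z ^ 2 ^ q) = z * Y z := by
      intro w hw hwsol
      refine eventually_nhdsGE_of_nhdsGT ?_ ?_
      · rcases hw with ⟨hp', -⟩ | ⟨q', hp', -, Z, r, -, -, -, hZ⟩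
        · omega
        · obtain rfl : q = q' := by exact_mod_cast hp'
          have := hZ.self_of_nhdsWithin self_mem_Ici
          simpa using this
      · have h1 : ∀ᶠ z in 𝓝[>] (0 : ℝ), |w (τ * z ^ 2 ^ q) / z - τ * s| < ε := by
          have := (hw.tendsto.sub_const ((τ : ℝ) * s)).abs
          rw [sub_self, abs_zero] at this
          exact this.eventually_lt_const hε
        filter_upwards [huniq, h1, self_mem_nhdsWithin, nhdsWithin_mono 0 Ioi_subset_Ici_self
          ((tendsto_pow_nhdsGE hq0).eventually hwsol)] with z h2 h3 h4 h5
        have hz : z ≠ 0 := ne_of_gt h4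
        rw [← h2 _ h3 (by rwa [mul_div_cancel₀ _ hz]), mul_div_cancel₀ _ hz]
    have h1 := (key v hv hsol).and (key v' hv' hsol')
    filter_upwards [(tendsto_root_nhdsGE q).eventually h1, self_mem_nhdsWithin] with t ht ht0
    rw [rpow_inv_two_pow_pow (mem_Ici.1 ht0)] at ht
    rw [ht.1, ht.2]

/-- Every continuous solution of the cell equation has an order and a slope, and they satisfy the
conditions. -/
theorem exists_order_slope_of_cell_solution (hk : 0 < k) (hf : f ∈ internalFamilies k)
    (ha : dInternal2 f ≠ 0) (hb : dInternalParam f ≠ 0) {τ : SignType} (hτ : τ ≠ 0)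
    {u : Fin k → ℝ → ℝ} {P : Fin k → ℤ} {S : Fin k → ℝ}
    (h : ∀ i, HasBranchForm τ (u i) (P i) (S i))
    (hgen : ∀ q : ℕ, 0 < q → (∃ i, P i = q - 1) →
      ∑ i ∈ Finset.univ.filter (fun i : Fin k => P i = q - 1), dInput f i * S i ≠ 0)
    {v : ℝ → ℝ} {r : ℝ} (hr : 0 < r) (hvc : ContinuousOn (fun t => v (τ * t)) (Ico 0 r))
    (hv0 : v 0 = 0)
    (hsol : ∀ᶠ t in 𝓝[≥] (0 : ℝ), f (v (τ * t), (fun i => u i (τ * t)), τ * t) = 0) :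
    ∃ p s, HasBranchForm τ v p s ∧ CellConditions f τ p s P S := by
  have hττ := signType_mul_self hτ
  have hτ0 := signType_cast_ne_zero hτ
  have hP : ∀ i, -1 ≤ P i := by
    intro i
    rcases h i with ⟨hp, -⟩ | ⟨q, hp, -⟩ <;> omega
  obtain ⟨i₀, -, hmax⟩ := Finset.exists_max_image (Finset.univ : Finset (Fin k)) P
    ⟨⟨0, hk⟩, Finset.mem_univ _⟩
  obtain ⟨q, hq⟩ := Int.eq_ofNat_of_zero_le (by have := hP i₀; omega : 0 ≤ P i₀ + 1)
  have hi₀ : P i₀ = q - 1 := by omega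
  have hle : ∀ i, P i ≤ q - 1 := fun i => by have := hmax i (Finset.mem_univ i); omega
  have hlt : ∀ i, P i < q := fun i => by have := hle i; omega
  have hq0 : (2 ^ q : ℕ) ≠ 0 := by positivity
  obtain ⟨ξ, ρ, hρ, hξ, hξ0, hu⟩ := exists_rescale_inputs h hlt
  have hμ0 := rescaled_param_zero τ q
  have hμz := rescaled_param τ q
  set A := ∑ i ∈ Finset.univ.filter (fun i : Fin k => P i = q - 1), dInput f i * S i with hA
  have hA0 : q = 0 → A = 0 := by
    rintro rfl
    refine Finset.sum_eq_zero fun i hi => ?_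
    have h1 : P i = -1 := by simpa using hi
    rw [(h i).order_eq_neg_one_iff.1 h1, mul_zero]
  have hAq : q ≠ 0 → A ≠ 0 := fun hq => hgen q (Nat.pos_of_ne_zero hq) ⟨i₀, hi₀⟩
  -- The rescaled component, as a function of `z = |l| ^ (2 ^ (-q))`.
  have hmaps : MapsTo (fun z : ℝ => z ^ 2 ^ q) (Ioo 0 (min r 1)) (Ico 0 r) := by
    intro z hz
    refine ⟨pow_nonneg hz.1.le _, ?_⟩
    calc z ^ 2 ^ q ≤ z ^ 1 := pow_le_pow_of_le_one hz.1.le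
          (hz.2.le.trans (min_le_right _ _)) (Nat.one_le_iff_ne_zero.2 hq0)
      _ < r := by rw [pow_one]; exact hz.2.trans_le (min_le_left _ _)
  have hXc : ContinuousOn (fun z : ℝ => v (τ * z ^ 2 ^ q)) (Ioo 0 (min r 1)) :=
    hvc.comp (continuous_pow _).continuousOn hmaps
  have hX0 : Tendsto (fun z : ℝ => v (τ * z ^ 2 ^ q)) (𝓝[>] 0) (𝓝 0) := by
    have h1 : Tendsto (fun t => v (τ * t)) (𝓝[≥] 0) (𝓝 0) := by
      have := hvc 0 ⟨le_rfl, hr⟩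
      rw [ContinuousWithinAt, mul_zero, hv0, nhdsWithin_Ico_eq_nhdsGE hr] at this
      exact this
    exact (h1.comp (tendsto_pow_nhdsGE hq0)).mono_left (nhdsWithin_mono 0 Ioi_subset_Ici_self)
  have hXsol : ∀ᶠ z in 𝓝[≥] (0 : ℝ), f (v (τ * z ^ 2 ^ q), (fun i => u i (τ * z ^ 2 ^ q)),
      τ * z ^ 2 ^ q) = 0 := (tendsto_pow_nhdsGE hq0).eventually hsol
  have hXsol' : ∀ᶠ z in 𝓝[>] (0 : ℝ),
      f (v (τ * z ^ 2 ^ q), z ^ 2 • ξ z, z * (τ * z ^ (2 ^ q - 1))) = 0 := by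
    filter_upwards [nhdsWithin_mono 0 Ioi_subset_Ici_self hXsol,
      nhdsWithin_mono 0 Ioi_subset_Ici_self hu] with z h1 h2
    rwa [hμz, ← h2]
  have hD : (dInternalParam f * ((τ : ℝ) * 0 ^ (2 ^ q - 1))) ^ 2 -
      2 * dInternal2 f * ∑ i, dInput f i * ξ 0 i ≠ 0 := by
    simp only [hξ0, sum_leading_inputs, hμ0, ← hA]
    by_cases hq' : q = 0
    · rw [hA0 hq', if_pos hq', mul_zero, mul_zero, sub_zero]
      exact pow_ne_zero 2 (mul_ne_zero hb hτ0)
    · rw [if_neg hq', mul_zero, zero_pow two_ne_zero, zero_sub]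
      exact neg_ne_zero.2 (mul_ne_zero (mul_ne_zero two_ne_zero ha) (mul_ne_zero hτ0 (hAq hq')))
  obtain ⟨y₀, hy1, hy2, hy3⟩ := exists_tendsto_div_of_solution hf ha
    (continuousAt_zero_of_contDiffOn hρ hξ)
    (μ := fun z => (τ : ℝ) * z ^ (2 ^ q - 1)) (by fun_prop) (lt_min hr one_pos) hXc hX0 hXsol' hD
  rw [hξ0, hμ0] at hy1
  rw [hμ0] at hy2
  obtain ⟨Y, σ, hσ, hY, hY0, -, ε, hε, huniq⟩ := exists_cell_branch hf h hlt hy1 hy2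
  have hXY : ∀ᶠ z in 𝓝[≥] (0 : ℝ), v (τ * z ^ 2 ^ q) = z * Y z := by
    refine eventually_nhdsGE_of_nhdsGT (by simp [hv0]) ?_
    have h1 : ∀ᶠ z in 𝓝[>] (0 : ℝ), |v (τ * z ^ 2 ^ q) / z - y₀| < ε := by
      have := (hy3.sub_const y₀).abs
      rw [sub_self, abs_zero] at this
      exact this.eventually_lt_const hε
    filter_upwards [huniq, h1, self_mem_nhdsWithin,
      nhdsWithin_mono 0 Ioi_subset_Ici_self hXsol] with z h2 h3 h4 h5
    have hz : z ≠ 0 := ne_of_gt h4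
    rw [← h2 _ h3 (by rwa [mul_div_cancel₀ _ hz]), mul_div_cancel₀ _ hz]
  rw [leadingForm, sum_leading_inputs, ← hA] at hy1
  by_cases hy0 : y₀ = 0
  · -- The root `0` occurs only for vanishing inputs and belongs to the trivial solution.
    have hq' : q = 0 := by
      by_contra hq'
      rw [hy0, if_neg hq'] at hy1
      simp [hτ0, hAq hq'] at hy1
    subst hq'
    have hPall : ∀ i, P i = -1 := fun i => by have := hle i; have := hP i; simp at *; omega
    refine ⟨-1, 0, Or.inl ⟨rfl, rfl, eventually_nhdsGE_of_nhdsGT (by simp [hv0]) ?_⟩,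
      ⟨le_rfl, fun _ => hPall, fun h => absurd h (lt_irrefl _), by simp, by simp, by simp⟩⟩
    filter_upwards [huniq, nhdsWithin_mono 0 Ioi_subset_Ici_self hXY,
      nhdsWithin_mono 0 Ioi_subset_Ici_self (HasBranchForm.input_eq_zero h hPall)] with z h1 h2 h3
    simp only [pow_zero, pow_one] at h1 h2
    rw [h2, ← h1 0 (by simpa [hy0] using hε) (by rw [h3, mul_zero]; exact hf.2.1 _), mul_zero]
  · have hs : (τ : ℝ) * y₀ ≠ 0 := mul_ne_zero hτ0 hy0
    refine ⟨q, τ * y₀, Or.inr ⟨q, rfl, hs, Y, σ, hσ, hY, ?_, hXY⟩, by omega, fun h => by omega,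
      fun _ => ⟨hle, i₀, hi₀⟩, ?_, fun hq' => ?_, fun hq' => ?_⟩
    · rw [hY0, ← mul_assoc, hττ, one_mul]
    · exact iff_of_false (by omega) hs
    · have hq'' : q = 0 := by exact_mod_cast hq'
      rw [hA0 hq'', if_pos hq''] at hy1
      have h1 : y₀ * (dInternal2 f * y₀ + 2 * (dInternalParam f * τ)) = 0 := by linarith
      have h2 := (mul_eq_zero.1 h1).resolve_left hy0
      field_simp
      linear_combination (τ : ℝ) * h2 - 2 * dInternalParam f * hττ
    · have hq'' : q ≠ 0 := by rintro rfl; simp at hq'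
      rw [if_neg hq'', mul_zero, zero_mul, add_zero] at hy1
      have h1 : ((τ : ℝ) * y₀) ^ 2 = cellRadicand f τ q P S := by
        rw [cellRadicand, ← hA, mul_pow, sq, hττ]
        field_simp
        linear_combination 2 * hy1
      have h2 : √(cellRadicand f τ q P S) = |(τ : ℝ) * y₀| := by rw [← h1, Real.sqrt_sq_eq_abs]
      refine ⟨h1 ▸ sq_nonneg _, ?_⟩
      rw [h2]
      rcases abs_choice ((τ : ℝ) * y₀) with h3 | h3
      · exact Or.inl h3.symm
      · right; rw [h3, neg_neg]

end Cell

/-! ### Branches on one side of `0` -/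

section Side

section Generic

variable {k : ℕ} {f : ℝ × (Fin k → ℝ) × ℝ → ℝ}

/-- The slope prescribed for a cell by its inputs of maximal order lies in the next family. -/
theorem exists_mem_slopeFamily_succ {P : Fin k → ℤ} {S : Fin k → ℝ}
    (h : ∀ i, 0 ≤ P i → ∃ t ∈ slopeFamily k (P i).toNat, t (coefficients f) = S i) {q : ℕ}
    (hq : ∃ i, P i = q) :
    (∃ t ∈ slopeFamily k (q + 1), t (coefficients f) = √|2 / dInternal2 f *
      ∑ i ∈ Finset.univ.filter (fun i : Fin k => P i = q), dInput f i * S i|) ∧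
    ∃ t ∈ slopeFamily k (q + 1), t (coefficients f) = -√|2 / dInternal2 f *
      ∑ i ∈ Finset.univ.filter (fun i : Fin k => P i = q), dInput f i * S i| := by
  have h' : ∀ i, P i = q → ∃ t ∈ slopeFamily k q, t (coefficients f) = S i := by
    intro i hi
    have := h i (by omega)
    rwa [hi, Int.toNat_natCast] at this
  obtain ⟨i₀, hi₀⟩ := hq
  obtain ⟨t₀, ht₀, -⟩ := h' i₀ hi₀
  have h2 : ∀ i, ∃ t ∈ slopeFamily k q, P i = q → t (coefficients f) = S i := by
    intro i
    by_cases hi : P i = q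
    · obtain ⟨t, ht, hts⟩ := h' i hi
      exact ⟨t, ht, fun _ => hts⟩
    · exact ⟨t₀, ht₀, fun hi' => absurd hi' hi⟩
  choose t ht hts using h2
  have hsum : ∑ i ∈ Finset.univ.filter (fun i : Fin k => P i = q),
      dInput f i * t i (coefficients f) =
      ∑ i ∈ Finset.univ.filter (fun i : Fin k => P i = q), dInput f i * S i :=
    Finset.sum_congr rfl fun i hi => by rw [hts i (by simpa using hi)]
  have hne : (Finset.univ.filter (fun i : Fin k => P i = q)).Nonempty := ⟨i₀, by simpa using hi₀⟩
  rw [← hsum]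
  exact ⟨⟨_, ⟨_, t, hne, ht, Or.inl rfl⟩, rfl⟩, ⟨_, ⟨_, t, hne, ht, Or.inr rfl⟩, rfl⟩⟩

/-- Genericity in the form in which it is used: the inputs of maximal order do not cancel in the
leading form. -/
theorem leading_input_ne_zero {m : ℕ} (hG : coefficients f ∈ genericCoefficients k m)
    {P : Fin k → ℤ} {S : Fin k → ℝ}
    (h : ∀ i, 0 ≤ P i → ∃ t ∈ slopeFamily k (P i).toNat, t (coefficients f) = S i) {q : ℕ}
    (hq0 : 0 < q) (hqm : q ≤ m) (hq : ∃ i, P i = q - 1) :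
    ∑ i ∈ Finset.univ.filter (fun i : Fin k => P i = q - 1), dInput f i * S i ≠ 0 := by
  obtain ⟨q, rfl⟩ := Nat.exists_eq_add_of_le' hq0
  have hq' : ((q + 1 : ℕ) : ℤ) - 1 = q := by push_cast; ring
  rw [hq'] at hq
  rw [hq']
  obtain ⟨⟨t, ht, hts⟩, -⟩ := exists_mem_slopeFamily_succ h hq
  intro h0
  refine hG.2.2.2 (q + 1) hqm t ht ?_
  rw [hts, h0, mul_zero, abs_zero, Real.sqrt_zero]

theorem CellConditions.exists_mem_slopeFamily {τ : SignType} (hτ : τ ≠ 0) {p : ℤ} {s : ℝ}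
    {P : Fin k → ℤ} {S : Fin k → ℝ} (hc : CellConditions f τ p s P S)
    (h : ∀ i, 0 ≤ P i → ∃ t ∈ slopeFamily k (P i).toNat, t (coefficients f) = S i)
    (hp : 0 ≤ p) : ∃ t ∈ slopeFamily k p.toNat, t (coefficients f) = s := by
  rcases hp.eq_or_lt with rfl | hp
  · exact ⟨_, rfl, (hc.slope_of_eq_zero rfl).symm⟩
  · obtain ⟨q, rfl⟩ : ∃ q : ℕ, p = q + 1 := ⟨(p - 1).toNat, by omega⟩
    have hin := (hc.input_of_neg_one_lt (by omega)).2
    obtain ⟨h1, h2⟩ := hc.slope_of_pos hp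
    have hq : (q : ℤ) + 1 - 1 = q := by ring
    rw [hq] at hin
    have h3 : cellRadicand f τ (q + 1) P S = |2 / dInternal2 f *
        ∑ i ∈ Finset.univ.filter (fun i : Fin k => P i = q), dInput f i * S i| := by
      rw [← abs_of_nonneg h1, cellRadicand, hq]
      simp only [abs_mul, abs_neg, abs_div]
      have : |(τ : ℝ)| = 1 := by cases τ <;> simp_all
      rw [this, mul_one]
    rw [h3] at h2
    have h4 := exists_mem_slopeFamily_succ h hin
    have h5 : ((q : ℤ) + 1).toNat = q + 1 := by omega
    rw [h5]
    rcases h2 with rfl | rfl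
    exacts [h4.1, h4.2]

/-- In a cell that receives only from itself, the only small equilibrium is `0`. -/
theorem eventually_eq_zero_of_self_coupled (hf : f ∈ internalFamilies k)
    (hsum : ∑ i, dInput f i ≠ 0) {τ : SignType} {v : ℝ → ℝ}
    (hv : Tendsto (fun t => v (τ * t)) (𝓝[≥] 0) (𝓝 0))
    (hsol : ∀ᶠ t in 𝓝[≥] (0 : ℝ), f (v (τ * t), (fun _ => v (τ * t)), τ * t) = 0) :
    ∀ᶠ t in 𝓝[≥] (0 : ℝ), v (τ * t) = 0 := by
  have hs : HasStrictFDerivAt f (fderiv ℝ f 0) 0 :=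
    hf.1.contDiffAt.hasStrictFDerivAt (by simp)
  have hl : Tendsto (fun t : ℝ => (τ : ℝ) * t) (𝓝[≥] 0) (𝓝 0) := by
    have : Tendsto (fun t : ℝ => (τ : ℝ) * t) (𝓝 0) (𝓝 (τ * 0)) :=
      (continuous_const_mul _).tendsto 0
    rw [mul_zero] at this
    exact this.mono_left nhdsWithin_le_nhds
  have ht : Tendsto (fun t : ℝ => ((v (τ * t), (fun _ : Fin k => v (τ * t)), (τ : ℝ) * t),
      ((0 : ℝ), (0 : Fin k → ℝ), (τ : ℝ) * t))) (𝓝[≥] 0) (𝓝 (0, 0)) := by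
    refine Tendsto.prodMk_nhds (hv.prodMk_nhds (Tendsto.prodMk_nhds ?_ hl))
      (tendsto_const_nhds.prodMk_nhds (tendsto_const_nhds.prodMk_nhds hl))
    exact tendsto_pi_nhds.2 fun _ => hv
  have h1 := (hs.isLittleO.comp_tendsto ht).def (half_pos (abs_pos.2 hsum))
  filter_upwards [h1, hsol] with t h2 h3
  by_contra hne
  have h4 : (v (τ * t), (fun _ : Fin k => v (τ * t)), (τ : ℝ) * t) -
      ((0 : ℝ), (0 : Fin k → ℝ), (τ : ℝ) * t) =
      (v (τ * t), 0, 0) + (0, (fun _ => v (τ * t)), 0) := by simp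
  have h5 : ‖(v (τ * t), (fun _ : Fin k => v (τ * t)), (τ : ℝ) * t) -
      ((0 : ℝ), (0 : Fin k → ℝ), (τ : ℝ) * t)‖ ≤ |v (τ * t)| := by
    have h6 : ‖fun _ : Fin k => v (τ * t)‖ ≤ |v (τ * t)| :=
      (pi_norm_le_iff_of_nonneg (abs_nonneg _)).2 fun _ => le_rfl
    simpa [Prod.norm_def] using h6
  simp only [Function.comp] at h2
  rw [h3, hf.2.1, h4, map_add, fderiv_internal_eq_zero hf, fderiv_input_eq_sum hf, ← h4,
    ← Finset.sum_mul] at h2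
  simp only [sub_self, zero_add, zero_sub, norm_neg, Real.norm_eq_abs, abs_mul] at h2
  have h6 : 0 < |v (τ * t)| := abs_pos.2 hne
  have h7 : 0 < |∑ i, dInput f i| := abs_pos.2 hsum
  have h8 := h2.trans (mul_le_mul_of_nonneg_left h5 (half_pos h7).le)
  nlinarith [mul_pos h6 h7]

end Generic

variable {C : Type*} {k : ℕ} {N : Network C k} {f : ℝ × (Fin k → ℝ) × ℝ → ℝ}

/-- A function `layer` exhibiting the layers `0, …, m` of a feed-forward network, as far as the
directions of the edges are concerned. -/
structure IsLayering (N : Network C k) (m : ℕ) (layer : C → ℕ) : Prop where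
  le : ∀ c, layer c ≤ m
  input_of_eq_zero : ∀ c, layer c = 0 → ∀ i, N.input i c = c
  layer_input : ∀ c j, layer c = j + 1 → ∀ i, layer (N.input i c) = j

theorem Network.IsFeedForward.exists_isLayering (hN : N.IsFeedForward) :
    ∃ m layer, IsLayering N m layer := by
  obtain ⟨m, layer, h1, h2, h3, -⟩ := hN
  exact ⟨m, layer, fun c => (h1 _).1 ⟨c, rfl⟩, h2, h3⟩

/-- A cell of layer `0` is its own input, so its order cannot exceed that of its inputs. -/
theorem IsLayering.order_eq_neg_one {m : ℕ} {layer : C → ℕ} (hL : IsLayering N m layer)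
    (hk : 0 < k) {δ : SignType} {p : C → ℤ} {s : C → ℝ}
    (hc : ∀ c, CellConditions f δ (p c) (s c) (fun i => p (N.input i c))
      (fun i => s (N.input i c))) {c : C} (h : layer c = 0) : p c = -1 := by
  by_contra hp
  have h1 := ((hc c).input_of_neg_one_lt (lt_of_le_of_ne (hc c).neg_one_le (Ne.symm hp))).1
    ⟨0, hk⟩
  simp only [hL.input_of_eq_zero c h] at h1
  omega

/-- Every equilibrium branch on one side of `0` has orders and slopes at all cells, and they satisfy
the conditions of admissible data. -/
theorem exists_orders_slopes (hk : 0 < k) (hf : f ∈ internalFamilies k) {m : ℕ} {layer : C → ℕ}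
    (hL : IsLayering N m layer) (hG : coefficients f ∈ genericCoefficients k m) {τ : SignType}
    (hτ : τ ≠ 0) {x : ℝ → C → ℝ} {r : ℝ} (hr : 0 < r)
    (hxc : ∀ c, ContinuousOn (fun t => x (τ * t) c) (Ico 0 r)) (hx0 : x 0 = 0)
    (hsol : ∀ c, ∀ᶠ t in 𝓝[≥] (0 : ℝ), N.field f (x (τ * t)) (τ * t) c = 0) :
    ∃ (p : C → ℤ) (s : C → ℝ), ∀ c, HasBranchForm τ (fun l => x l c) (p c) (s c) ∧
      CellConditions f τ (p c) (s c) (fun i => p (N.input i c)) (fun i => s (N.input i c)) := by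
  have hzero : ∀ c, layer c = 0 → HasBranchForm τ (fun l => x l c) (-1) 0 := by
    intro c hc
    refine Or.inl ⟨rfl, rfl, eventually_eq_zero_of_self_coupled (v := fun l => x l c) hf
      hG.2.2.1 ?_ ?_⟩
    · have := hxc c 0 ⟨le_rfl, hr⟩
      rw [ContinuousWithinAt, mul_zero, hx0, nhdsWithin_Ico_eq_nhdsGE hr] at this
      exact this
    · filter_upwards [hsol c] with t ht
      simpa [Network.field, hL.input_of_eq_zero c hc] using ht
  have hstep : ∀ c j, layer c = j + 1 → ∀ (P : Fin k → ℤ) (S : Fin k → ℝ),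
      (∀ i, HasBranchForm τ (fun l => x l (N.input i c)) (P i) (S i)) → (∀ i, P i ≤ j) →
      (∀ i, 0 ≤ P i → ∃ t ∈ slopeFamily k (P i).toNat, t (coefficients f) = S i) →
      ∃ p s, HasBranchForm τ (fun l => x l c) p s ∧ CellConditions f τ p s P S := by
    intro c j hc P S hPS hPj hfam
    refine exists_order_slope_of_cell_solution hk hf hG.1 hG.2.1 hτ hPS
      (fun q hq0 hq => leading_input_ne_zero hG hfam hq0 ?_ hq) hr (hxc c)
      (by simp [hx0]) (hsol c)
    obtain ⟨i, hi⟩ := hq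
    have h1 := hPj i
    have h2 := hL.le c
    omega
  have hex : ∀ n c, layer c = n → ∃ (p : ℤ) (s : ℝ), HasBranchForm τ (fun l => x l c) p s ∧
      p ≤ layer c ∧ (0 ≤ p → ∃ t ∈ slopeFamily k p.toNat, t (coefficients f) = s) := by
    intro n
    induction n with
    | zero =>
      intro c hc
      exact ⟨-1, 0, hzero c hc, by omega, by omega⟩
    | succ j ih =>
      intro c hc
      choose P S h1 h2 h3 using fun i => ih (N.input i c) (hL.layer_input c j hc i)
      have h2' : ∀ i, P i ≤ j := fun i => by
        have := h2 i; rwa [hL.layer_input c j hc i] at this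
      obtain ⟨p, s, hp, hcc⟩ := hstep c j hc P S h1 h2' h3
      refine ⟨p, s, hp, ?_, hcc.exists_mem_slopeFamily hτ h3⟩
      by_cases hp1 : -1 < p
      · obtain ⟨i, hi⟩ := (hcc.input_of_neg_one_lt hp1).2
        have := h2' i
        omega
      · omega
  choose p s hps hpl hfam using fun c => hex (layer c) c rfl
  refine ⟨p, s, fun c => ⟨hps c, ?_⟩⟩
  rcases Nat.eq_zero_or_eq_succ_pred (layer c) with hc | hc
  · obtain ⟨hp, hs⟩ := (hps c).unique hτ (hzero c hc)
    simp only [hL.input_of_eq_zero c hc, hp, hs]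
    exact ⟨le_rfl, fun _ _ => rfl, by simp, by simp, by simp, by simp⟩
  · have hlay := hL.layer_input c _ hc
    obtain ⟨p', s', hp', hcc⟩ := hstep c _ hc (fun i => p (N.input i c))
      (fun i => s (N.input i c)) (fun i => hps _)
      (fun i => by have := hpl (N.input i c); rwa [hlay i] at this) (fun i => hfam _)
    obtain ⟨rfl, rfl⟩ := (hps c).unique hτ hp'
    exact hcc

/-- On one side of `0`, an equilibrium branch is determined by its orders and slopes. -/
theorem eventually_eq_of_orders_slopes (hk : 0 < k) (hf : f ∈ internalFamilies k)
    (ha : dInternal2 f ≠ 0) (hb : dInternalParam f ≠ 0) {m : ℕ} {layer : C → ℕ}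
    (hL : IsLayering N m layer) {τ : SignType} (hτ : τ ≠ 0) {p : C → ℤ} {s : C → ℝ}
    (hc : ∀ c, CellConditions f τ (p c) (s c) (fun i => p (N.input i c))
      (fun i => s (N.input i c))) {x x' : ℝ → C → ℝ}
    (hx : ∀ c, HasBranchForm τ (fun l => x l c) (p c) (s c))
    (hx' : ∀ c, HasBranchForm τ (fun l => x' l c) (p c) (s c))
    (hsol : ∀ c, ∀ᶠ t in 𝓝[≥] (0 : ℝ), N.field f (x (τ * t)) (τ * t) c = 0)
    (hsol' : ∀ c, ∀ᶠ t in 𝓝[≥] (0 : ℝ), N.field f (x' (τ * t)) (τ * t) c = 0) (c : C) :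
    ∀ᶠ t in 𝓝[≥] (0 : ℝ), x (τ * t) c = x' (τ * t) c := by
  generalize hn : layer c = n
  induction n generalizing c with
  | zero =>
    have hp := hL.order_eq_neg_one hk hc hn
    rcases hx c with ⟨-, -, h0⟩ | ⟨q, hq, -⟩
    · rcases hx' c with ⟨-, -, h0'⟩ | ⟨q, hq, -⟩
      · filter_upwards [h0, h0'] with t h1 h2
        rw [h1, h2]
      · omega
    · omega
  | succ j ih =>
    have h1 := eventually_all.2 fun i => ih (N.input i c) (hL.layer_input c j hn i)
    refine cell_solution_unique (v := fun l => x l c) (v' := fun l => x' l c)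
      hf ha hb hτ (fun i => hx (N.input i c)) (hc c) (hx c) (hx' c) (hsol c) ?_
    filter_upwards [hsol' c, h1] with t h2 h3
    simp only [h3]
    exact h2

/-- All data satisfying the cell conditions on one side of `0` are realised by solutions there. -/
theorem exists_side_solution (hk : 0 < k) (hf : f ∈ internalFamilies k)
    (ha : dInternal2 f ≠ 0) (hb : dInternalParam f ≠ 0) {m : ℕ} {layer : C → ℕ}
    (hL : IsLayering N m layer) {τ : SignType} (hτ : τ ≠ 0) {p : C → ℤ} {s : C → ℝ}
    (hc : ∀ c, CellConditions f τ (p c) (s c) (fun i => p (N.input i c))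
      (fun i => s (N.input i c))) :
    ∃ x : ℝ → C → ℝ, ∀ c, HasBranchForm τ (fun l => x l c) (p c) (s c) ∧
      ∀ᶠ t in 𝓝[≥] (0 : ℝ), N.field f (x (τ * t)) (τ * t) c = 0 := by
  have key : ∀ n, ∃ x : ℝ → C → ℝ, ∀ c, layer c < n →
      HasBranchForm τ (fun l => x l c) (p c) (s c) ∧
      ∀ᶠ t in 𝓝[≥] (0 : ℝ), N.field f (x (τ * t)) (τ * t) c = 0 := by
    intro n
    induction n with
    | zero => exact ⟨0, fun c hc => absurd hc (Nat.not_lt_zero _)⟩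
    | succ n ih =>
      obtain ⟨x, hx⟩ := ih
      have hv : ∀ c, ∃ v : ℝ → ℝ, layer c = n → HasBranchForm τ v (p c) (s c) ∧
          ∀ᶠ t in 𝓝[≥] (0 : ℝ), f (v (τ * t),
            (fun i => if layer (N.input i c) = n then v (τ * t) else x (τ * t) (N.input i c)),
            τ * t) = 0 := by
        intro c
        by_cases hcn : layer c = n
        · rcases n with _ | j
          · refine ⟨fun _ => 0, fun _ => ⟨Or.inl ⟨hL.order_eq_neg_one hk hc hcn, ?_, by simp⟩, ?_⟩⟩
            · exact (hc c).eq_neg_one_iff.1 (hL.order_eq_neg_one hk hc hcn)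
            · simp only [hL.input_of_eq_zero c hcn, hcn, if_true]
              exact Eventually.of_forall fun t => hf.2.1 _
          · have hlay := hL.layer_input c j hcn
            obtain ⟨v, hv1, hv2⟩ := exists_cell_solution hf ha hb hτ
              (u := fun i l => x l (N.input i c))
              (fun i => (hx (N.input i c) (by rw [hlay i]; omega)).1) (hc c)
            refine ⟨v, fun _ => ⟨hv1, ?_⟩⟩
            simpa [hlay] using hv2
        · exact ⟨0, fun h => absurd h hcn⟩
      choose v hv using hv
      refine ⟨fun l c => if layer c = n then v c l else x l c, fun c hcn => ?_⟩
      by_cases hcn' : layer c = n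
      · obtain ⟨h1, h2⟩ := hv c hcn'
        simp only [hcn', if_true]
        refine ⟨h1, ?_⟩
        simp only [Network.field, hcn', if_true]
        filter_upwards [h2] with t ht
        convert ht using 4
        funext i
        split_ifs with hi
        · rcases n with _ | j
          · rw [hL.input_of_eq_zero c hcn']
          · rw [hL.layer_input c j hcn' i] at hi; omega
        · rfl
      · have hlt : layer c < n := by omega
        have hin : ∀ i, layer (N.input i c) ≠ n := by
          intro i
          rcases Nat.eq_zero_or_eq_succ_pred (layer c) with h0 | h0
          · rw [hL.input_of_eq_zero c h0]; exact hcn'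
          · rw [hL.layer_input c _ h0 i]; omega
        simpa [Network.field, hcn', hin] using hx c hlt
  obtain ⟨x, hx⟩ := key (m + 1)
  exact ⟨x, fun c => hx c (Nat.lt_succ_of_le (hL.le c))⟩

/-! ### Curves with prescribed data -/

theorem HasBranchForm.apply_zero {τ : SignType} {u : ℝ → ℝ} {p : ℤ} {s : ℝ}
    (h : HasBranchForm τ u p s) : u 0 = 0 := by
  rcases h with ⟨-, -, h0⟩ | ⟨q, -, -, Y, r, -, -, -, h0⟩
  · simpa using h0.self_of_nhdsWithin self_mem_Ici
  · simpa using h0.self_of_nhdsWithin self_mem_Ici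

/-- All admissible data are realised by an equilibrium curve. -/
theorem exists_curve [Fintype C] (hk : 0 < k) (hf : f ∈ internalFamilies k)
    (ha : dInternal2 f ≠ 0) (hb : dInternalParam f ≠ 0) {m : ℕ} {layer : C → ℕ}
    (hL : IsLayering N m layer) {δ : SignType} {p : C → ℤ} {s : C → ℝ}
    (hd : (δ, p, s) ∈ admissibleData N f) :
    ∃ e : Curve C, e.sign = δ ∧ e.IsEquilibrium N f ∧ ∀ τ : SignType, τ ≠ 0 → (δ = 0 ∨ δ = τ) →
      ∀ c, HasBranchForm τ (fun l => e.toFun l c) (p c) (s c) := by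
  obtain ⟨hδ, hc⟩ := mem_admissibleData_iff.1 hd
  by_cases hδ0 : δ = 0
  · have hp0 := hδ.1 hδ0
    have hp : ∀ c, p c = 0 ∨ p c = -1 := fun c => by
      have := hp0 c; have := (hc c).neg_one_le; omega
    have hin : ∀ c i, p (N.input i c) = -1 := by
      intro c i
      rcases hp c with h | h
      · have h1 := ((hc c).input_of_neg_one_lt (by omega)).1 i
        have h2 := hp (N.input i c)
        omega
      · exact (hc c).input_of_eq_neg_one h i
    -- On both sides of `0`, the nonzero components all follow the transcritical branch.
    obtain ⟨Y, ρ, hρ, -, hY, hY0, hsol, -⟩ := exists_localBranch hf one_pos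
      (ξ := fun _ => 0) (μ := fun _ => 1) contDiffOn_const contDiffOn_const
      (y₀ := -(2 * dInternalParam f / dInternal2 f))
      (by simp [leadingForm]; field_simp; ring)
      (by rw [mul_one, mul_neg, mul_div_cancel₀ _ ha]; intro h; apply hb; linarith)
    simp only [smul_zero, mul_one] at hsol
    have hcd : ContDiffOn ℝ ∞ (fun (l : ℝ) (c : C) => if p c = 0 then l * Y l else 0)
        (Ioo (-ρ) ρ) := by
      refine contDiffOn_pi.2 fun c => ?_
      by_cases h : p c = 0
      · simp only [h, if_true]; exact contDiffOn_id.mul hY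
      · simp only [h, if_false]; exact contDiffOn_const
    refine ⟨⟨0, ρ, hρ, fun l c => if p c = 0 then l * Y l else 0, hcd.continuousOn, ?_⟩,
      hδ0.symm, ⟨?_, ?_⟩, ?_⟩
    · exact hcd.mono interior_subset
    · funext c; simp
    · intro l hl
      funext c
      have h1 : (fun i => if p (N.input i c) = 0 then l * Y l else 0) = 0 := by
        funext i; simp [hin c i]
      simp only [Network.field, h1, Pi.zero_apply]
      rcases hp c with h | h
      · simpa [h] using hsol l hl
      · simpa [h] using! hf.2.1 l
    · intro τ hτ _ c
      rcases hp c with h | h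
      · have hsc := (hc c).slope_of_eq_zero h
        have hs0 : s c ≠ 0 := fun hs => by have := (hc c).eq_neg_one_iff.2 hs; omega
        refine Or.inr ⟨0, by simpa using h, hs0, fun z => τ * Y (τ * z), ρ, hρ, ?_, ?_, ?_⟩
        · refine contDiffOn_const.mul (hY.comp (by fun_prop) fun z hz => ?_)
          have h1 : |(τ : ℝ) * z| = |z| := by
            rw [abs_mul]; cases τ <;> simp_all
          exact abs_lt.1 (h1 ▸ abs_lt.2 hz)
        · simp [hY0, hsc]
        · refine Eventually.of_forall fun z => ?_
          simp [h]; ring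
      · exact Or.inl ⟨h, (hc c).eq_neg_one_iff.1 h, by simp [h]⟩
  · obtain ⟨x, hx⟩ := exists_side_solution hk hf ha hb hL hδ0 hc
    have h1 := eventually_all.2 fun c => (hx c).1.regular hδ0
    obtain ⟨r₀, hr₀, h2⟩ := eventually_nhdsGE_iff.1 (eventually_all.2 fun c => (hx c).2)
    obtain ⟨r, h3, hr⟩ := (h1.and (Ioo_mem_nhdsGT hr₀)).exists
    refine ⟨⟨δ, r, hr.1, x, continuousOn_pi.2 fun c => (h3 c).1,
      contDiffOn_pi.2 fun c => (h3 c).2⟩, rfl, ⟨?_, ?_⟩, ?_⟩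
    · funext c; exact (hx c).1.apply_zero
    · intro l hl
      have hl' := (mem_domainSet_iff hδ0).1 hl
      have h4 := h2 _ (abs_nonneg l) (hl'.2.trans hr.2)
      rw [← hl'.1] at h4
      exact funext h4
    · rintro τ hτ (h | rfl) c
      · exact absurd h hδ0
      · exact (hx c).1

end Side

/-! ### One-sided derivatives at `0` -/

section Germs

theorem domainSet_mono {τ : SignType} (hτ : τ ≠ 0) {ρ r : ℝ} (h : ρ ≤ r) :
    domainSet τ ρ ⊆ domainSet τ r := fun l hl => by
  rw [mem_domainSet_iff hτ] at hl ⊢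
  exact ⟨hl.1, hl.2.trans_le h⟩

theorem zero_mem_domainSet {τ : SignType} (hτ : τ ≠ 0) {r : ℝ} (hr : 0 < r) :
    (0 : ℝ) ∈ domainSet τ r := by
  rw [mem_domainSet_iff hτ]; simpa using hr

theorem uniqueDiffWithinAt_domainSet {τ : SignType} (hτ : τ ≠ 0) {r : ℝ} (hr : 0 < r) :
    UniqueDiffWithinAt ℝ (domainSet τ r) 0 := by
  cases τ with
  | zero => exact absurd rfl hτ
  | pos => exact uniqueDiffOn_Ico 0 r 0 ⟨le_rfl, hr⟩
  | neg => exact uniqueDiffOn_Ioc (-r) 0 0 ⟨by linarith, le_rfl⟩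

theorem domainSet_mem_nhdsWithin {τ : SignType} (hτ : τ ≠ 0) {ρ r : ℝ} (hρ : 0 < ρ) :
    domainSet τ ρ ∈ 𝓝[domainSet τ r] 0 := by
  filter_upwards [self_mem_nhdsWithin,
    mem_nhdsWithin_of_mem_nhds (Metric.ball_mem_nhds (0 : ℝ) hρ)] with l h1 h2
  rw [mem_domainSet_iff hτ] at h1 ⊢
  exact ⟨h1.1, by simpa using h2⟩

/-- A one-sided derivative at `0`, in terms of the distance `z = |l|` from `0`. -/
theorem hasDerivWithinAt_domainSet_iff {τ : SignType} (hτ : τ ≠ 0) {r : ℝ} (hr : 0 < r)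
    {u : ℝ → ℝ} (hu : u 0 = 0) {s : ℝ} : HasDerivWithinAt u s (domainSet τ r) 0 ↔
      Tendsto (fun z => u (τ * z) / z) (𝓝[>] 0) (𝓝 (τ * s)) := by
  have hττ := signType_mul_self hτ
  have hτ0 := signType_cast_ne_zero hτ
  rw [hasDerivWithinAt_iff_tendsto_slope]
  constructor
  · intro h
    have h1 : Tendsto (fun z : ℝ => (τ : ℝ) * z) (𝓝[>] 0) (𝓝[domainSet τ r \ {0}] 0) := by
      refine tendsto_nhdsWithin_iff.2 ⟨?_, ?_⟩
      · have : Tendsto (fun z : ℝ => (τ : ℝ) * z) (𝓝 0) (𝓝 (τ * 0)) :=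
          (continuous_const_mul _).tendsto 0
        rw [mul_zero] at this
        exact this.mono_left nhdsWithin_le_nhds
      · filter_upwards [Ioo_mem_nhdsGT hr] with z hz
        exact ⟨signType_mul_mem_domainSet hτ hz.1.le hz.2, mul_ne_zero hτ0 hz.1.ne'⟩
    refine ((h.comp h1).const_mul (τ : ℝ)).congr' ?_
    filter_upwards [self_mem_nhdsWithin] with z hz
    have hz0 : z ≠ 0 := ne_of_gt hz
    simp only [Function.comp, slope_def_field, hu, sub_zero]
    field_simp
  · intro h
    have h1 : Tendsto (fun l : ℝ => |l|) (𝓝[domainSet τ r \ {0}] 0) (𝓝[>] 0) := by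
      refine tendsto_nhdsWithin_iff.2 ⟨?_, ?_⟩
      · have : Tendsto (fun l : ℝ => |l|) (𝓝 0) (𝓝 |0|) := continuous_abs.tendsto 0
        rw [abs_zero] at this
        exact this.mono_left nhdsWithin_le_nhds
      · filter_upwards [self_mem_nhdsWithin] with l hl
        exact abs_pos.2 hl.2
    have h2 := (h.comp h1).const_mul (τ : ℝ)
    rw [← mul_assoc, hττ, one_mul] at h2
    refine h2.congr' ?_
    filter_upwards [self_mem_nhdsWithin] with l hl
    have hl1 := ((mem_domainSet_iff hτ).1 hl.1).1
    have hl0 : l ≠ 0 := hl.2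
    have hl2 : |l| = τ * l := by
      have : (τ : ℝ) * l = τ * (τ * |l|) := by rw [← hl1]
      rw [this, ← mul_assoc, hττ, one_mul]
    simp only [Function.comp, slope_def_field, hu, sub_zero]
    rw [← hl1, hl2]
    field_simp

theorem HasBranchForm.hasDerivWithinAt {τ : SignType} (hτ : τ ≠ 0) {u : ℝ → ℝ} {p : ℤ} {s : ℝ}
    (h : HasBranchForm τ u p s) (hp : p ≤ 0) {r : ℝ} (hr : 0 < r) :
    HasDerivWithinAt u s (domainSet τ r) 0 := by
  rw [hasDerivWithinAt_domainSet_iff hτ hr h.apply_zero]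
  have hform := h
  rcases h with ⟨-, rfl, h0⟩ | ⟨q, rfl, -⟩
  · rw [mul_zero]
    refine tendsto_const_nhds.congr' ?_
    filter_upwards [nhdsWithin_mono 0 Ioi_subset_Ici_self h0] with z hz
    rw [hz, zero_div]
  · obtain rfl : q = 0 := by omega
    simpa using hform.tendsto

/-- Components of positive square-root-order are not differentiable at `0`. -/
theorem HasBranchForm.of_hasDerivWithinAt {τ : SignType} (hτ : τ ≠ 0) {u : ℝ → ℝ} {p : ℤ} {s : ℝ}
    (h : HasBranchForm τ u p s) {r : ℝ} (hr : 0 < r) {d : ℝ}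
    (hd : HasDerivWithinAt u d (domainSet τ r) 0) : p ≤ 0 ∧ s = d := by
  have hp : p ≤ 0 := by
    by_contra! hp
    have h1 := (hasDerivWithinAt_domainSet_iff hτ hr h.apply_zero).1 hd
    obtain ⟨q, rfl⟩ := Int.eq_ofNat_of_zero_le hp.le
    have hs : s ≠ 0 := fun hs => by have := h.order_eq_neg_one_iff.2 hs; omega
    exact not_tendsto_lower_root (q' := 0) (mul_ne_zero (signType_cast_ne_zero hτ) hs) h.tendsto
      (by omega) (by simpa using h1)
  exact ⟨hp, (uniqueDiffWithinAt_domainSet hτ hr).eq_deriv _ (h.hasDerivWithinAt hτ hp hr) hd⟩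

/-! ### Germs of curves -/

variable {C : Type*} [Fintype C]

theorem Curve.domainSet_subset (b : Curve C) {τ : SignType} (hτ : τ ≠ 0)
    (h : b.sign = 0 ∨ b.sign = τ) : domainSet τ b.radius ⊆ b.dom := by
  intro l hl
  rcases h with h | h
  · have := ((mem_domainSet_iff hτ).1 hl).2
    rw [Curve.dom, h]
    exact abs_lt.1 this
  · rwa [Curve.dom, h]

theorem Curve.exists_side (b : Curve C) : ∃ τ : SignType, τ ≠ 0 ∧ (b.sign = 0 ∨ b.sign = τ) := by
  by_cases h : b.sign = 0
  · exact ⟨1, by decide, Or.inl h⟩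
  · exact ⟨b.sign, h, Or.inr rfl⟩

/-- The part of a curve on one side of `0`. -/
def Curve.restrict (b : Curve C) {τ : SignType} (hτ : τ ≠ 0) (h : b.sign = 0 ∨ b.sign = τ) :
    Curve C where
  sign := τ
  radius := b.radius
  radius_pos := b.radius_pos
  toFun := b.toFun
  continuousOn_toFun := b.continuousOn_toFun.mono (b.domainSet_subset hτ h)
  smoothOn_toFun := b.smoothOn_toFun.mono (interior_mono (b.domainSet_subset hτ h))

theorem inter_ne_singleton_of_common_side {b₁ b₂ : Curve C} {τ : SignType} (hτ : τ ≠ 0)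
    (h₁ : b₁.sign = 0 ∨ b₁.sign = τ) (h₂ : b₂.sign = 0 ∨ b₂.sign = τ) {ε : ℝ} (hε : 0 < ε) :
    Metric.ball 0 ε ∩ b₁.dom ∩ b₂.dom ≠ {0} := by
  intro h
  have hρ : 0 < min ε (min b₁.radius b₂.radius) :=
    lt_min hε (lt_min b₁.radius_pos b₂.radius_pos)
  set t := min ε (min b₁.radius b₂.radius) / 2 with ht
  have ht0 : 0 < t := half_pos hρ
  have htρ : t < min ε (min b₁.radius b₂.radius) := half_lt_self hρ
  have h1 : (τ : ℝ) * t ∈ Metric.ball 0 ε ∩ b₁.dom ∩ b₂.dom := by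
    refine ⟨⟨?_, b₁.domainSet_subset hτ h₁ (signType_mul_mem_domainSet hτ ht0.le ?_)⟩,
      b₂.domainSet_subset hτ h₂ (signType_mul_mem_domainSet hτ ht0.le ?_)⟩
    · rw [mem_ball_zero_iff, Real.norm_eq_abs, abs_signType_mul hτ ht0.le]
      exact htρ.trans_le (min_le_left _ _)
    · exact htρ.trans_le ((min_le_right _ _).trans (min_le_left _ _))
    · exact htρ.trans_le ((min_le_right _ _).trans (min_le_right _ _))
  rw [h] at h1
  exact mul_ne_zero (signType_cast_ne_zero hτ) ht0.ne' h1

/-- Curves that agree on one side of `0` have the same germ. -/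
theorem Curve.germ_eq_of_eventually_eq {b e : Curve C} {τ : SignType} (hτ : τ ≠ 0)
    (hb : b.sign = 0 ∨ b.sign = τ) (he : e.sign = 0 ∨ e.sign = τ)
    (h : ∀ᶠ t in 𝓝[≥] (0 : ℝ), b.toFun (τ * t) = e.toFun (τ * t)) : b.germ = e.germ := by
  have h1 : (b.restrict hτ hb).germ = b.germ :=
    Quot.sound ⟨Metric.ball 0 1, Metric.isOpen_ball, Metric.mem_ball_self one_pos,
      inter_ne_singleton_of_common_side hτ (Or.inr rfl) hb one_pos, fun _ _ => rfl⟩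
  obtain ⟨ε, hε, h2⟩ := eventually_nhdsGE_iff.1 h
  rw [← h1]
  refine Quot.sound ⟨Metric.ball 0 ε, Metric.isOpen_ball, Metric.mem_ball_self hε,
    inter_ne_singleton_of_common_side hτ (Or.inr rfl) he hε, fun l hl => ?_⟩
  have hl1 : l ∈ domainSet τ b.radius := hl.1.2
  rw [mem_domainSet_iff hτ] at hl1
  have h3 := h2 |l| (abs_nonneg l) (by simpa using hl.1.1)
  rw [← hl1.1] at h3
  exact h3

theorem GermEquivalent.symm {b₁ b₂ : Curve C} (h : GermEquivalent b₁ b₂) :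
    GermEquivalent b₂ b₁ := by
  obtain ⟨U, hU, h0, hne, heq⟩ := h
  rw [inter_right_comm] at hne heq
  exact ⟨U, hU, h0, hne, heq.symm⟩

theorem GermEquivalent.exists_common_side {b₁ b₂ : Curve C} (h : GermEquivalent b₁ b₂) :
    ∃ τ : SignType, τ ≠ 0 ∧ (b₁.sign = 0 ∨ b₁.sign = τ) ∧ (b₂.sign = 0 ∨ b₂.sign = τ) ∧
      ∃ ρ > 0, ρ ≤ b₁.radius ∧ EqOn b₁.toFun b₂.toFun (domainSet τ ρ) := by
  obtain ⟨U, hU, h0, hne, heq⟩ := h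
  have hside : ∃ τ : SignType, τ ≠ 0 ∧ (b₁.sign = 0 ∨ b₁.sign = τ) ∧
      (b₂.sign = 0 ∨ b₂.sign = τ) := by
    by_cases h1 : b₁.sign = 0
    · obtain ⟨τ, hτ, h2⟩ := b₂.exists_side
      exact ⟨τ, hτ, Or.inl h1, h2⟩
    by_cases h2 : b₂.sign = 0
    · exact ⟨b₁.sign, h1, Or.inr rfl, Or.inl h2⟩
    by_cases h3 : b₂.sign = b₁.sign
    · exact ⟨b₁.sign, h1, Or.inr rfl, Or.inr h3⟩
    -- Domains on opposite sides meet only in `0`.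
    exfalso
    apply hne
    refine Subset.antisymm (fun l hl => ?_) (singleton_subset_iff.2 ⟨⟨h0, ?_⟩, ?_⟩)
    · have h4 := ((mem_domainSet_iff h1).1 hl.1.2).1
      have h5 := ((mem_domainSet_iff h2).1 hl.2).1
      have h6 : ((b₁.sign : ℝ) - b₂.sign) * |l| = 0 := by rw [sub_mul, ← h4, ← h5, sub_self]
      rcases mul_eq_zero.1 h6 with h7 | h7
      · exfalso
        apply h3
        have h8 : ∀ σ σ' : SignType, (σ : ℝ) - σ' = 0 → σ' = σ := by
          intro σ σ' h
          cases σ <;> cases σ' <;> first | rfl | (exfalso; norm_num at h)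
        exact h8 _ _ h7
      · exact abs_eq_zero.1 h7
    · exact zero_mem_domainSet h1 b₁.radius_pos
    · exact zero_mem_domainSet h2 b₂.radius_pos
  obtain ⟨τ, hτ, h1, h2⟩ := hside
  obtain ⟨ε, hε, hball⟩ := Metric.isOpen_iff.1 hU 0 h0
  refine ⟨τ, hτ, h1, h2, min ε (min b₁.radius b₂.radius),
    lt_min hε (lt_min b₁.radius_pos b₂.radius_pos),
    (min_le_right _ _).trans (min_le_left _ _), heq.mono fun l hl => ?_⟩
  have hl' := ((mem_domainSet_iff hτ).1 hl).2
  refine ⟨⟨hball ?_, b₁.domainSet_subset hτ h1 (domainSet_mono hτ ?_ hl)⟩,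
    b₂.domainSet_subset hτ h2 (domainSet_mono hτ ?_ hl)⟩
  · rw [mem_ball_zero_iff, Real.norm_eq_abs]
    exact hl'.trans_le (min_le_left _ _)
  · exact (min_le_right _ _).trans (min_le_left _ _)
  · exact (min_le_right _ _).trans (min_le_right _ _)

/-- A property of curves that is preserved by the generating relation depends only on the germ. -/
theorem Curve.of_germ_eq {Q : Curve C → Prop} (hQ : ∀ b₁ b₂, GermEquivalent b₁ b₂ → Q b₁ → Q b₂)
    {b b' : Curve C} (h : b.germ = b'.germ) (hb : Q b) : Q b' := by
  have h1 := congrArg (Quot.lift Q fun b₁ b₂ h12 =>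
    propext ⟨hQ b₁ b₂ h12, hQ b₂ b₁ h12.symm⟩) h
  exact cast h1 hb

theorem Curve.differentiableAt_zero (b : Curve C) (h : b.sign = 0) :
    DifferentiableAt ℝ b.toFun 0 := by
  have h1 : domainSet b.sign b.radius = Ioo (-b.radius) b.radius := by rw [h]; rfl
  have h2 := b.smoothOn_toFun
  rw [h1, interior_Ioo] at h2
  exact (h2.contDiffAt (Ioo_mem_nhds (by linarith [b.radius_pos]) b.radius_pos)).differentiableAt
    (by simp)

/-- The derivative at `0` within the domain is an invariant of the germ. -/
theorem Curve.hasDerivWithinAt_of_germ_eq {b b' : Curve C} (h : b.germ = b'.germ) {s : C → ℝ}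
    (hb : HasDerivWithinAt b.toFun s b.dom 0) : HasDerivWithinAt b'.toFun s b'.dom 0 := by
  refine Curve.of_germ_eq (Q := fun b => HasDerivWithinAt b.toFun s b.dom 0) ?_ h hb
  intro b₁ b₂ h12 h1
  obtain ⟨τ, hτ, hs1, hs2, ρ, hρ, hρ1, heq⟩ := h12.exists_common_side
  have h2 : HasDerivWithinAt b₂.toFun s (domainSet τ ρ) 0 :=
    (h1.mono ((domainSet_mono hτ hρ1).trans (b₁.domainSet_subset hτ hs1))).congr
      heq.symm (heq (zero_mem_domainSet hτ hρ)).symm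
  rcases hs2 with hs2 | hs2
  · have h3 := (b₂.differentiableAt_zero hs2).hasDerivAt
    have h4 := (uniqueDiffWithinAt_domainSet hτ hρ).eq_deriv _ h2 h3.hasDerivWithinAt
    rw [h4]
    exact h3.hasDerivWithinAt
  · have h3 : b₂.dom = domainSet τ b₂.radius := by rw [Curve.dom, hs2]
    rw [h3]
    exact h2.mono_of_mem_nhdsWithin (domainSet_mem_nhdsWithin hτ hρ)

/-- A germ that is not differentiable at `0` lives on one side only, and its representatives agree
near `0`. -/
theorem Curve.eventually_eq_of_germ_eq {b b' : Curve C} (h : b.germ = b'.germ)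
    {τ : SignType} (hτ : τ ≠ 0) (hb : b.sign = 0 ∨ b.sign = τ)
    (hnd : ∀ ρ > 0, ∀ s : C → ℝ, ¬ HasDerivWithinAt b.toFun s (domainSet τ ρ) 0) :
    b'.sign = τ ∧ ∀ᶠ t in 𝓝[≥] (0 : ℝ), b.toFun (τ * t) = b'.toFun (τ * t) := by
  have hsign : ∀ b' : Curve C, (b'.sign = 0 ∨ b'.sign = τ) →
      (∀ᶠ t in 𝓝[≥] (0 : ℝ), b.toFun (τ * t) = b'.toFun (τ * t)) → b'.sign = τ := by
    intro b' hs hev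
    refine hs.resolve_left fun hs0 => ?_
    obtain ⟨ε, hε, h1⟩ := eventually_nhdsGE_iff.1 hev
    have h2 : EqOn b.toFun b'.toFun (domainSet τ ε) := by
      intro l hl
      rw [mem_domainSet_iff hτ] at hl
      have := h1 |l| (abs_nonneg l) hl.2
      rwa [← hl.1] at this
    exact hnd ε hε _ ((b'.differentiableAt_zero hs0).hasDerivAt.hasDerivWithinAt.congr h2
      (h2 (zero_mem_domainSet hτ hε)))
  refine Curve.of_germ_eq (Q := fun b' => b'.sign = τ ∧
    ∀ᶠ t in 𝓝[≥] (0 : ℝ), b.toFun (τ * t) = b'.toFun (τ * t)) ?_ h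
    ⟨hsign b hb (Eventually.of_forall fun _ => rfl), Eventually.of_forall fun _ => rfl⟩
  rintro b₁ b₂ h12 ⟨h1, h2⟩
  obtain ⟨τ', hτ', hs1, hs2, ρ, hρ, -, heq⟩ := h12.exists_common_side
  obtain rfl : τ = τ' := by
    rcases hs1 with hs1 | hs1
    · exact absurd (h1.symm.trans hs1) hτ
    · exact h1.symm.trans hs1
  have h3 : ∀ᶠ t in 𝓝[≥] (0 : ℝ), b.toFun (τ * t) = b₂.toFun (τ * t) := by
    filter_upwards [h2, Ico_mem_nhdsGE hρ] with t h4 h5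
    rw [h4]
    exact heq (signType_mul_mem_domainSet hτ h5.1 h5.2)
  exact ⟨hsign b₂ hs2 h3, h3⟩

theorem HasDomainSign.unique {β : CurveGerm C} {b : Curve C} (hb : b.germ = β) {δ δ' : SignType}
    (h : HasDomainSign β δ) (h' : HasDomainSign β δ') : δ = δ' := by
  rcases h with ⟨rfl, e, he, he0⟩ | ⟨h0, h⟩ <;> rcases h' with ⟨rfl, e', he', he0'⟩ | ⟨h0', h'⟩
  · rfl
  · exact he0.symm.trans (h' e he)
  · exact (h e' he').symm.trans he0'
  · exact (h b hb).symm.trans (h' b hb)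

end Germs

/-! ### The data of equilibrium branches -/

section Data

variable {C : Type*} [Fintype C] {k : ℕ} {N : Network C k} {f : ℝ × (Fin k → ℝ) × ℝ → ℝ}

theorem Curve.IsEquilibrium.eventually_field_eq_zero {b : Curve C} (hb : b.IsEquilibrium N f)
    {τ : SignType} (hτ : τ ≠ 0) (hs : b.sign = 0 ∨ b.sign = τ) (c : C) :
    ∀ᶠ t in 𝓝[≥] (0 : ℝ), N.field f (b.toFun (τ * t)) (τ * t) c = 0 := by
  filter_upwards [Ico_mem_nhdsGE b.radius_pos] with t ht
  exact congrFun (hb.2 _ (b.domainSet_subset hτ hs (signType_mul_mem_domainSet hτ ht.1 ht.2))) c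

theorem Curve.IsEquilibrium.exists_orders_slopes {b : Curve C} (hb : b.IsEquilibrium N f)
    (hk : 0 < k) (hf : f ∈ internalFamilies k) {m : ℕ} {layer : C → ℕ}
    (hL : IsLayering N m layer) (hG : coefficients f ∈ genericCoefficients k m) {τ : SignType}
    (hτ : τ ≠ 0) (hs : b.sign = 0 ∨ b.sign = τ) :
    ∃ (p : C → ℤ) (s : C → ℝ), ∀ c, HasBranchForm τ (fun l => b.toFun l c) (p c) (s c) ∧
      CellConditions f τ (p c) (s c) (fun i => p (N.input i c)) (fun i => s (N.input i c)) := by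
  refine FeedForward.exists_orders_slopes hk hf hL hG hτ b.radius_pos (fun c => ?_) hb.1
    (hb.eventually_field_eq_zero hτ hs)
  have h1 : ContinuousOn (fun l => b.toFun l c) (domainSet τ b.radius) :=
    (continuousOn_pi.1 b.continuousOn_toFun c).mono (b.domainSet_subset hτ hs)
  exact h1.comp (by fun_prop) fun t ht => signType_mul_mem_domainSet hτ ht.1 ht.2

/-- Two equilibrium curves with the same orders and slopes on a common side have the same germ. -/
theorem Curve.IsEquilibrium.germ_eq {b e : Curve C} (hb : b.IsEquilibrium N f)
    (he : e.IsEquilibrium N f) (hk : 0 < k) (hf : f ∈ internalFamilies k)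
    (ha : dInternal2 f ≠ 0) (hb0 : dInternalParam f ≠ 0) {m : ℕ} {layer : C → ℕ}
    (hL : IsLayering N m layer) {τ : SignType} (hτ : τ ≠ 0) (hbs : b.sign = 0 ∨ b.sign = τ)
    (hes : e.sign = 0 ∨ e.sign = τ) {p : C → ℤ} {s : C → ℝ}
    (hc : ∀ c, CellConditions f τ (p c) (s c) (fun i => p (N.input i c))
      (fun i => s (N.input i c)))
    (hbf : ∀ c, HasBranchForm τ (fun l => b.toFun l c) (p c) (s c))
    (hef : ∀ c, HasBranchForm τ (fun l => e.toFun l c) (p c) (s c)) : b.germ = e.germ := by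
  refine Curve.germ_eq_of_eventually_eq hτ hbs hes ?_
  have h1 := eventually_eq_of_orders_slopes hk hf ha hb0 hL hτ hc hbf hef
    (hb.eventually_field_eq_zero hτ hbs) (he.eventually_field_eq_zero hτ hes)
  filter_upwards [eventually_all.2 h1] with t ht
  exact funext ht

/-- Every equilibrium branch has branch data, and they are admissible. -/
theorem exists_isBranchData (hk : 0 < k) (hf : f ∈ internalFamilies k) {m : ℕ} {layer : C → ℕ}
    (hL : IsLayering N m layer) (hG : coefficients f ∈ genericCoefficients k m) {b : Curve C}
    (hb : b.IsEquilibrium N f) :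
    ∃ d ∈ admissibleData N f, IsBranchData N f b.germ d := by
  obtain ⟨τ, hτ, hs⟩ := b.exists_side
  obtain ⟨p, s, hps⟩ := hb.exists_orders_slopes hk hf hL hG hτ hs
  by_cases hp : ∀ c, p c ≤ 0
  · have hadm : ((0 : SignType), p, s) ∈ admissibleData N f := by
      refine mem_admissibleData_iff.2 ⟨iff_of_true rfl hp, fun c => ?_⟩
      have h := (hps c).2
      exact ⟨h.1, h.2, h.3, h.4, h.5, fun h0 => absurd h0 (hp c).not_gt⟩
    obtain ⟨e, he0, he, hef⟩ := exists_curve hk hf hG.1 hG.2.1 hL hadm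
    have hbe : b.germ = e.germ := hb.germ_eq he hk hf hG.1 hG.2.1 hL hτ hs (Or.inl he0)
      (fun c => (hps c).2) (fun c => (hps c).1) (hef τ hτ (Or.inl rfl))
    have hd : HasDerivWithinAt e.toFun s e.dom 0 := by
      have h1 := (e.differentiableAt_zero he0).hasDerivAt
      have h2 : HasDerivWithinAt e.toFun s (domainSet τ 1) 0 :=
        hasDerivWithinAt_pi.2 fun c =>
          (hef τ hτ (Or.inl rfl) c).hasDerivWithinAt hτ (hp c) one_pos
      rw [(uniqueDiffWithinAt_domainSet hτ one_pos).eq_deriv _ h2 h1.hasDerivWithinAt]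
      exact h1.hasDerivWithinAt
    refine ⟨(0, p, s), hadm, Or.inl ⟨rfl, e, hbe.symm, he0⟩, fun b' hb' hbeq c τ' hτ' hs' => ?_⟩
    -- The orders and slopes on any side can be read off from the derivative at `0`.
    obtain ⟨p', s', hps'⟩ := hbeq.exists_orders_slopes hk hf hL hG hτ' hs'
    have hd' := (Curve.hasDerivWithinAt_of_germ_eq (hbe.symm.trans hb'.symm) hd).mono
      (b'.domainSet_subset hτ' hs')
    obtain ⟨hp', hs''⟩ := (hps' c).1.of_hasDerivWithinAt hτ' b'.radius_pos
      (hasDerivWithinAt_pi.1 hd' c)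
    have hpp : p' c = p c := by
      have h1 := (hps' c).1.order_eq_neg_one_iff
      have h2 := (hps c).1.order_eq_neg_one_iff
      rw [hs''] at h1
      have h3 := (hps' c).2.neg_one_le
      have h4 := (hps c).2.neg_one_le
      have h5 := hp c
      have h6 := h1.trans h2.symm
      omega
    have h7 := (hps' c).1.hasOrderAndSlope hτ'
    rwa [hpp, hs''] at h7
  · have hp' := hp
    push Not at hp'
    obtain ⟨c₀, hc₀⟩ := hp'
    have hnd : ∀ ρ > 0, ∀ s : C → ℝ, ¬ HasDerivWithinAt b.toFun s (domainSet τ ρ) 0 := by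
      intro ρ hρ s' h
      have := ((hps c₀).1.of_hasDerivWithinAt hτ hρ (hasDerivWithinAt_pi.1 h c₀)).1
      omega
    refine ⟨(τ, p, s), mem_admissibleData_iff.2 ⟨iff_of_false hτ hp, fun c => (hps c).2⟩,
      Or.inr ⟨hτ, fun b' hb' => (Curve.eventually_eq_of_germ_eq hb'.symm hτ hs hnd).1⟩,
      fun b' hb' hbeq c τ' hτ' hs' => ?_⟩
    obtain ⟨h1, h2⟩ := Curve.eventually_eq_of_germ_eq hb'.symm hτ hs hnd
    obtain rfl : τ = τ' := by
      rcases hs' with h | h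
      · exact absurd (h1.symm.trans h) hτ
      · exact h1.symm.trans h
    exact ((hps c).1.congr (h2.mono fun t ht => congrFun ht c)).hasOrderAndSlope hτ

/-- One representative and one side on which it is defined determine all orders and slopes. -/
theorem IsBranchData.unique {b : Curve C} (hb : b.IsEquilibrium N f)
    {d d' : SignType × (C → ℤ) × (C → ℝ)} (h : IsBranchData N f b.germ d)
    (h' : IsBranchData N f b.germ d') : d = d' := by
  obtain ⟨τ, hτ, hs⟩ := b.exists_side
  have h1 := fun c => (h.2 b rfl hb c τ hτ hs).unique hτ (h'.2 b rfl hb c τ hτ hs)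
  exact Prod.ext (h.1.unique rfl h'.1)
    (Prod.ext (funext fun c => (h1 c).1) (funext fun c => (h1 c).2))

/-- A branch with admissible data `d` is the germ of every equilibrium curve realising `d`. -/
theorem germ_eq_of_isBranchData (hk : 0 < k) (hf : f ∈ internalFamilies k) {m : ℕ}
    {layer : C → ℕ} (hL : IsLayering N m layer) (hG : coefficients f ∈ genericCoefficients k m)
    {δ : SignType} {p : C → ℤ} {s : C → ℝ} {b e : Curve C} (hb : b.IsEquilibrium N f)
    (hd : IsBranchData N f b.germ (δ, p, s)) (he : e.IsEquilibrium N f) (heδ : e.sign = δ)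
    (hef : ∀ τ : SignType, τ ≠ 0 → (δ = 0 ∨ δ = τ) →
      ∀ c, HasBranchForm τ (fun l => e.toFun l c) (p c) (s c)) : b.germ = e.germ := by
  obtain ⟨τ, hτ, hs⟩ := b.exists_side
  have hδ : δ = 0 ∨ δ = τ := by
    rcases hd.1 with ⟨h0, -⟩ | ⟨h0, h1⟩
    · exact Or.inl h0
    · have h2 := h1 b rfl
      exact Or.inr (by
        rcases hs with hs | hs
        · exact absurd (h2.symm.trans hs) h0
        · exact h2.symm.trans hs)
  obtain ⟨p', s', hps⟩ := hb.exists_orders_slopes hk hf hL hG hτ hs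
  have h1 := fun c => (hd.2 b rfl hb c τ hτ hs).unique hτ ((hps c).1.hasOrderAndSlope hτ)
  obtain rfl : p = p' := funext fun c => (h1 c).1
  obtain rfl : s = s' := funext fun c => (h1 c).2
  exact hb.germ_eq he hk hf hG.1 hG.2.1 hL hτ hs (by rwa [heδ]) (fun c => (hps c).2)
    (fun c => (hps c).1) (hef τ hτ hδ)

/-- All admissible data are the data of a branch. -/
theorem exists_curve_isBranchData (hk : 0 < k) (hf : f ∈ internalFamilies k) {m : ℕ}
    {layer : C → ℕ} (hL : IsLayering N m layer) (hG : coefficients f ∈ genericCoefficients k m)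
    {d : SignType × (C → ℤ) × (C → ℝ)} (hd : d ∈ admissibleData N f) :
    ∃ e : Curve C, e.IsEquilibrium N f ∧ IsBranchData N f e.germ d := by
  obtain ⟨δ, p, s⟩ := d
  obtain ⟨e, heδ, he, hef⟩ := exists_curve hk hf hG.1 hG.2.1 hL hd
  obtain ⟨⟨δ', p', s'⟩, hd', hbd⟩ := exists_isBranchData hk hf hL hG he
  obtain ⟨τ, hτ, hs⟩ := e.exists_side
  have h1 := fun c => (hbd.2 e rfl he c τ hτ hs).unique hτ
    ((hef τ hτ (by rwa [heδ] at hs) c).hasOrderAndSlope hτ)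
  obtain rfl : p' = p := funext fun c => (h1 c).1
  obtain rfl : s' = s := funext fun c => (h1 c).2
  have h2 := (mem_admissibleData_iff.1 hd).1
  have h3 := (mem_admissibleData_iff.1 hd').1
  have h4 : δ' = δ := by
    rcases hbd.1 with ⟨h0, -⟩ | ⟨-, h0⟩
    · exact h0.trans (h2.2 (h3.1 h0)).symm
    · exact (h0 e rfl).symm.trans heδ
  exact ⟨e, he, h4 ▸ hbd⟩

end Data

end FeedForward

end

theorem mainTheorem5 {C : Type*} [Fintype C] {k : ℕ} (hk : 0 < k)
    (N : FeedForward.Network C k) (hN : N.IsFeedForward) (hconn : N.IsConnected) :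
    ∃ G : Set ((Fin k → ℝ) × ℝ × ℝ), IsOpen G ∧ Dense G ∧
      ∀ f ∈ FeedForward.internalFamilies k, FeedForward.coefficients f ∈ G →
        ∃ Θ : FeedForward.equilibriumBranches N f → SignType × (C → ℤ) × (C → ℝ),
          (∀ (β : FeedForward.equilibriumBranches N f) (d : SignType × (C → ℤ) × (C → ℝ)),
            FeedForward.IsBranchData N f β d ↔ d = Θ β) ∧
          Function.Injective Θ ∧
          Set.range Θ = FeedForward.admissibleData N f := by
  obtain ⟨m, layer, hL⟩ := hN.exists_isLayering
  refine ⟨FeedForward.genericCoefficients k m, FeedForward.isOpen_genericCoefficients k m,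
    FeedForward.dense_genericCoefficients k m hk, fun f hf hG => ?_⟩
  choose b hbβ hb using fun β : FeedForward.equilibriumBranches N f => β.2
  choose Θ hΘadm hΘ using fun β => FeedForward.exists_isBranchData hk hf hL hG (hb β)
  have hΘ' : ∀ β : FeedForward.equilibriumBranches N f, FeedForward.IsBranchData N f β (Θ β) :=
    fun β => hbβ β ▸ hΘ β
  have huniq : ∀ (β : FeedForward.equilibriumBranches N f) d,
      FeedForward.IsBranchData N f β d → d = Θ β := fun β d hd =>
    FeedForward.IsBranchData.unique (hb β) ((hbβ β).symm ▸ hd) (hΘ β)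
  refine ⟨Θ, fun β d => ⟨huniq β d, fun h => h ▸ hΘ' β⟩, fun β β' h => ?_,
    Set.Subset.antisymm (Set.range_subset_iff.2 hΘadm) fun d hd => ?_⟩
  · obtain ⟨e, heδ, he, hef⟩ := FeedForward.exists_curve hk hf hG.1 hG.2.1 hL (hΘadm β)
    have h1 := FeedForward.germ_eq_of_isBranchData hk hf hL hG (hb β) (hΘ β) he heδ hef
    have h2 := FeedForward.germ_eq_of_isBranchData hk hf hL hG (hb β') (h ▸ hΘ β') he heδ hef
    exact Subtype.ext ((hbβ β).symm.trans ((h1.trans h2.symm).trans (hbβ β')))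
  · obtain ⟨e, he, hed⟩ := FeedForward.exists_curve_isBranchData hk hf hL hG hd
    exact ⟨⟨e.germ, e, rfl, he⟩, (huniq _ d hed).symm⟩
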